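/- For a Riemannian metric $g$ on $\mathbb R^n$, let $\sigma_-(g)(x)=0$ if all sectional curvatures of $g$ at $x$ are nonnegative, and otherwise let $-\sigma_-(g)(x)$ be the lowest sectional curvature of $g$ at $x$. Let $d\mathrm{vol}_g$ be the Riemannian volume measure of $g$ and $B_g(o,R)$ the geodesic ball of radius $R$ centered at the origin $o$. For every $n\ge 3$ there is a constant $C(n)>0$, depending only on $n$, such that for every $R>3$ there is a smooth function $f_R\colon\mathbb R^n\to\mathbb R$ for which the conformal metric $g_R=e^{2f_R}\,\mathrm{eucl}$ is complete and satisfies $$\sigma_-(g_R)\le C(n)\ \text{ on } \mathbb R^n,\qquad \int_{\mathbb R^n}\sigma_-(g_R)^{\frac n2}\,d\mathrm{vol}_{g_R}\le C(n),$$ and $$\mathrm{vol}_{g_R}\big(B_{g_R}(o,R)\big)\ge \frac{R^n(\log R)^{\frac n2-1}}{C(n)}.$$ -/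

import Mathlib

open scoped Manifold ContDiff ENNReal Bundle

noncomputable section

namespace RiemannianRn

section Metrics

variable {E : Type*} [NormedAddCommGroup E] [InnerProductSpace ℝ E]

/-- Smooth Riemannian metrics on the manifold `E`, a real inner product space. -/
abbrev RMetric (E : Type*) [NormedAddCommGroup E] [InnerProductSpace ℝ E] :=
  Bundle.ContMDiffRiemannianMetric 𝓘(ℝ, E) ∞ E (fun x : E => TangentSpace 𝓘(ℝ, E) x)

/-- The Euclidean metric. -/
abbrev eucl (E : Type*) [NormedAddCommGroup E] [InnerProductSpace ℝ E] :=
  riemannianMetricVectorSpace E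

/-- The conformal metric `e^{2f} eucl`, for a smooth function `f`. -/
def conformalMetric (f : E → ℝ) (hf : ContDiff ℝ ∞ f) : RMetric E where
  inner x := Real.exp (2 * f x) • (eucl E).inner x
  symm x v w := congrArg (Real.exp (2 * f x) * ·) ((eucl E).symm x v w)
  pos x v hv := mul_pos (Real.exp_pos _) ((eucl E).pos x v hv)
  isVonNBounded x := by
    change Bornology.IsVonNBounded ℝ {v : E | Real.exp (2 * f x) * inner ℝ v v < 1}
    refine (NormedSpace.isVonNBounded_ball ℝ E (Real.exp (-f x))).subset ?_
    intro v hv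
    have hv' : Real.exp (2 * f x) * inner ℝ v v < 1 := hv
    rw [real_inner_self_eq_norm_sq, two_mul, Real.exp_add] at hv'
    rw [Metric.mem_ball, dist_zero_right, Real.exp_neg, ← one_div,
      lt_div_iff₀ (Real.exp_pos _)]
    nlinarith [mul_nonneg (norm_nonneg v) (Real.exp_pos (f x)).le]
  contMDiff :=
    ContMDiff.smul_section (Real.contDiff_exp.comp (contDiff_const.mul hf)).contMDiff
      ((eucl E).contMDiff.of_le le_top)

/-- The Riemannian distance of `g`: the infimum of the `g`-lengths of `C¹` paths. -/
def distance (g : RMetric E) (x y : E) : ℝ≥0∞ :=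
  letI : Bundle.RiemannianBundle (fun x : E => TangentSpace 𝓘(ℝ, E) x) :=
    ⟨g.toRiemannianMetric⟩
  Manifold.riemannianEDist 𝓘(ℝ, E) x y

/-- The open geodesic ball of center `x` and radius `r`. -/
def geodesicBall (g : RMetric E) (x : E) (r : ℝ) : Set E :=
  {y | distance g x y < ENNReal.ofReal r}

/-- The metric `g` is complete: each Cauchy sequence for the Riemannian distance converges. -/
def IsCompleteMetric (g : RMetric E) : Prop :=
  ∀ u : ℕ → E,
    (∀ ε : ℝ≥0∞, 0 < ε → ∃ N, ∀ p ≥ N, ∀ q ≥ N, distance g (u p) (u q) < ε) →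
    ∃ x, Filter.Tendsto (fun p => distance g (u p) x) Filter.atTop (nhds 0)

end Metrics

section Curvature

variable {n : ℕ} (g : RMetric (EuclideanSpace ℝ (Fin n)))

/-- The matrix `(g_{ij}(x))` of the metric in the standard coordinates of `ℝⁿ`. -/
def gram (x : EuclideanSpace ℝ (Fin n)) : Matrix (Fin n) (Fin n) ℝ :=
  Matrix.of fun i j => g.inner x (EuclideanSpace.single i (1 : ℝ)) (EuclideanSpace.single j (1 : ℝ))

/-- The Riemannian volume measure `√(det (g_{ij})) dx`. -/
def vol : MeasureTheory.Measure (EuclideanSpace ℝ (Fin n)) :=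
  MeasureTheory.volume.withDensity fun x => ENNReal.ofReal √(gram g x).det

/-- The partial derivative `∂_i h` at `x`. -/
def partialDeriv (i : Fin n) (h : EuclideanSpace ℝ (Fin n) → ℝ)
    (x : EuclideanSpace ℝ (Fin n)) : ℝ :=
  fderiv ℝ h x (EuclideanSpace.single i (1 : ℝ))

/-- The Christoffel symbols of the Levi-Civita connection,
`Γ^k_{ij} = ½ ∑_l g^{kl} (∂_i g_{jl} + ∂_j g_{il} - ∂_l g_{ij})`. -/
def christoffel (k i j : Fin n) (x : EuclideanSpace ℝ (Fin n)) : ℝ :=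
  (1 / 2 : ℝ) * ∑ l, (gram g x)⁻¹ k l *
    (partialDeriv i (fun y => gram g y j l) x + partialDeriv j (fun y => gram g y i l) x
      - partialDeriv l (fun y => gram g y i j) x)

/-- The components of the curvature tensor, `R(∂_i, ∂_j) ∂_k = ∑_l R^l_{kij} ∂_l`, where
`R(X, Y) Z = ∇_X ∇_Y Z - ∇_Y ∇_X Z - ∇_{[X, Y]} Z`. -/
def riemann (l k i j : Fin n) (x : EuclideanSpace ℝ (Fin n)) : ℝ :=
  partialDeriv i (christoffel g l j k) x - partialDeriv j (christoffel g l i k) x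
    + ∑ m, (christoffel g l i m x * christoffel g m j k x
      - christoffel g l j m x * christoffel g m i k x)

/-- `g(R(u, v) v, u)` at the point `x`. -/
def curvatureForm (x u v : EuclideanSpace ℝ (Fin n)) : ℝ :=
  ∑ i, ∑ j, ∑ k, ∑ l, ∑ m, gram g x l m * riemann g l k i j x * u i * v j * v k * u m

/-- The sectional curvature at `x` of the plane spanned by the linearly independent vectors
`u` and `v`. -/
def sectionalCurvature (x u v : EuclideanSpace ℝ (Fin n)) : ℝ :=
  curvatureForm g x u v / (g.inner x u u * g.inner x v v - (g.inner x u v) ^ 2)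

/-- `σ₋(g)(x)`: zero if all the sectional curvatures at `x` are nonnegative, and otherwise
minus the lowest sectional curvature at `x`.  It is written here as the supremum, over all
planes in the tangent space at `x`, of `max (-sec) 0` (the map `ENNReal.ofReal` truncates
negative numbers to zero). -/
def sigmaMinus (x : EuclideanSpace ℝ (Fin n)) : ℝ≥0∞ :=
  ⨆ (u : EuclideanSpace ℝ (Fin n)) (v : EuclideanSpace ℝ (Fin n))
    (_ : LinearIndependent ℝ ![u, v]), ENNReal.ofReal (-sectionalCurvature g x u v)

end Curvature

end RiemannianRn

end

/-!
The metric is Euclidean space with many large round spheres attached to it through thin necks.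

Let `f = ψ (log r)` be radial about a point. In the coordinate `s = log r` the metric `e^{2f} eucl`
has curvature `-e^{-2f} ψ'' / r²` on planes containing the radius and
`-e^{-2f} (2ψ' + ψ'²) / r²` on planes orthogonal to it, all other planes lying in between
(`sigmaMinus_radial_le`). So as long as `-2 ≤ ψ' ≤ 0` only the convexity of `ψ` costs anything, and
since `dvol = e^{nf} r^{n-1} dr dσ`, the integral of `σ₋^{n/2}` is at most a constant times
`∫ max (ψ'', 0)^{n/2} ds` (`lintegral_sigmaMinus_bubbleSum_le`). Going inwards, let `ψ'` decrease
from `0` to `-2` over the interval `0 ≤ s ≤ ℓ`, with `0 ≤ ψ'' ≤ C / ℓ` there. This inverts the space,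
at the cost `ℓ · ℓ^{-n/2} = ℓ^{1-n/2}`: the spheres `r = const`, which shrink until the middle of the
neck, grow again behind it. Afterwards `ψ'` returns to `0`, where `ψ'' ≤ 0` is free, and closes the bubble by a
cap, whose size `e^{neckHeight ℓ - b}` is prescribed by the place `s = b` at which this happens.

With `L = log R` and `ℓ = L / 4` such a bubble is supported in a ball of radius `R^{1/4}`, and its cap
can be given the size of a small multiple of `R`, hence a volume of order `R^n`
(`le_vol_ball_bubbleSum`). Its cost is of order `L^{1-n/2}`, so that about `L^{n/2-1}` disjoint copies
are affordable (`bubble_cost_le`); this is the asserted volume. Their centres lie on a line parallel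
to a coordinate axis avoiding all bubbles, so each cap is reached from the origin by walking along
this axis for the short distance `O(R^{1/4} L^{n/2-1})` and then into the bubble along a ray
(`distance_zero_bubbleSum_le`). The metric is complete because `0 ≤ f` is bounded. For `R` below a
threshold depending only on `n`, the Euclidean metric itself will do.
-/

namespace RiemannianRn

open MeasureTheory Set Filter Topology

/-! ### Length and distance of conformal metrics -/

section Distance

variable {E : Type*} [NormedAddCommGroup E] [InnerProductSpace ℝ E]

/-- The norm of the Riemannian structure of `e^{2f} eucl` is `e^f` times the given norm. -/
theorem enorm_conformalMetric (f : E → ℝ) (hf : ContDiff ℝ ∞ f) (x v : E) :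
    let _ : Bundle.RiemannianBundle (fun x : E => TangentSpace 𝓘(ℝ, E) x) :=
      ⟨(conformalMetric f hf).toRiemannianMetric⟩
    let w : TangentSpace 𝓘(ℝ, E) x := v
    ‖w‖ₑ = ENNReal.ofReal (Real.exp (f x)) * ‖v‖ₑ := by
  intro _ w
  have h : ‖w‖ = Real.exp (f x) * ‖v‖ := by
    rw [norm_eq_sqrt_real_inner]
    have : inner ℝ w w = Real.exp (2 * f x) * inner ℝ v v := rfl
    rw [this, real_inner_self_eq_norm_sq, two_mul, Real.exp_add, ← pow_two, ← mul_pow,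
      Real.sqrt_sq (by positivity)]
  rw [← ofReal_norm w, h, ENNReal.ofReal_mul (Real.exp_pos _).le, ofReal_norm]

/-- A `C¹` path bounds the distance of a conformal metric by its weighted Euclidean length. -/
theorem distance_conformalMetric_le (f : E → ℝ) (hf : ContDiff ℝ ∞ f) {γ : ℝ → E}
    (hγ : ContDiffOn ℝ 1 γ (Icc 0 1)) :
    distance (conformalMetric f hf) (γ 0) (γ 1) ≤
      ∫⁻ t in Icc (0 : ℝ) 1,
        ENNReal.ofReal (Real.exp (f (γ t))) * ‖derivWithin γ (Icc 0 1) t‖ₑ := by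
  let _ : Bundle.RiemannianBundle (fun x : E => TangentSpace 𝓘(ℝ, E) x) :=
    ⟨(conformalMetric f hf).toRiemannianMetric⟩
  refine (Manifold.riemannianEDist_le_pathELength (I := 𝓘(ℝ, E)) (a := 0) (b := 1)
    (contMDiffOn_iff_contDiffOn.mpr hγ) rfl rfl zero_le_one).trans_eq ?_
  rw [Manifold.pathELength_eq_lintegral_mfderivWithin_Icc]
  refine lintegral_congr fun t => ?_
  simp only [mfderivWithin_eq_fderivWithin]
  exact enorm_conformalMetric f hf (γ t) _

theorem distance_conformalMetric_le_segment (f : E → ℝ) (hf : ContDiff ℝ ∞ f) (x v : E) :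
    distance (conformalMetric f hf) x (x + v) ≤
      ∫⁻ t in Icc (0 : ℝ) 1, ENNReal.ofReal (Real.exp (f (x + t • v))) * ‖v‖ₑ := by
  have hd : ∀ t, HasDerivAt (fun t : ℝ => x + t • v) v t := fun t => by
    simpa using ((hasDerivAt_id t).smul_const v).const_add x
  have h := distance_conformalMetric_le f hf (γ := fun t => x + t • v)
    (by fun_prop : ContDiff ℝ 1 fun t : ℝ => x + t • v).contDiffOn
  simp only [zero_smul, add_zero, one_smul] at h
  refine h.trans_eq (setLIntegral_congr_fun measurableSet_Icc fun t ht => ?_)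
  rw [(hd t).hasDerivWithinAt.derivWithin (uniqueDiffOn_Icc zero_lt_one t ht)]

theorem distance_conformalMetric_le_of_bound (f : E → ℝ) (hf : ContDiff ℝ ∞ f) (x v : E) {M : ℝ}
    (hM : ∀ t ∈ Icc (0 : ℝ) 1, f (x + t • v) ≤ M) :
    distance (conformalMetric f hf) x (x + v) ≤ ENNReal.ofReal (Real.exp M * ‖v‖) := by
  refine (distance_conformalMetric_le_segment f hf x v).trans ?_
  calc _ ≤ ∫⁻ t in Icc (0 : ℝ) 1, ENNReal.ofReal (Real.exp M * ‖v‖) := by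
        refine setLIntegral_mono measurable_const fun t ht => ?_
        rw [ENNReal.ofReal_mul (Real.exp_pos _).le, ofReal_norm]
        gcongr
        exact hM t ht
    _ = _ := by simp

theorem distance_comm (g : RMetric E) (x y : E) : distance g x y = distance g y x := by
  let _ : Bundle.RiemannianBundle (fun x : E => TangentSpace 𝓘(ℝ, E) x) :=
    ⟨g.toRiemannianMetric⟩
  exact Manifold.riemannianEDist_comm

theorem distance_triangle (g : RMetric E) (x y z : E) :
    distance g x z ≤ distance g x y + distance g y z := by
  let _ : Bundle.RiemannianBundle (fun x : E => TangentSpace 𝓘(ℝ, E) x) :=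
    ⟨g.toRiemannianMetric⟩
  exact Manifold.riemannianEDist_triangle

/-- If `0 ≤ f`, the metric `e^{2f} eucl` dominates the Euclidean one, and so do the distances. -/
theorem edist_le_distance_conformalMetric (f : E → ℝ) (hf : ContDiff ℝ ∞ f) (h0 : ∀ x, 0 ≤ f x)
    (x y : E) : edist x y ≤ distance (conformalMetric f hf) x y := by
  refine le_of_forall_gt fun r hr => ?_
  let _ : Bundle.RiemannianBundle (fun x : E => TangentSpace 𝓘(ℝ, E) x) :=
    ⟨(conformalMetric f hf).toRiemannianMetric⟩
  obtain ⟨γ, rfl, rfl, hγ, hlen⟩ :=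
    Manifold.exists_lt_of_riemannianEDist_lt (I := 𝓘(ℝ, E)) hr
  rw [Manifold.pathELength_eq_lintegral_mfderivWithin_Icc] at hlen
  refine lt_of_le_of_lt ?_ hlen
  rw [edist_comm, edist_eq_enorm_sub]
  refine (enorm_sub_le_lintegral_derivWithin_Icc_of_contDiffOn_Icc
    (contMDiffOn_iff_contDiffOn.mp hγ) zero_le_one).trans ?_
  refine lintegral_mono fun t => ?_
  simp only [mfderivWithin_eq_fderivWithin]
  refine le_trans ?_ (enorm_conformalMetric f hf (γ t) _).ge
  refine le_trans (le_of_eq ?_) (mul_le_mul_left (ENNReal.one_le_ofReal.2 (Real.one_le_exp (h0 _))) _)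
  rw [one_mul]
  rfl

/-- A conformal metric with bounded nonnegative exponent is uniformly equivalent to the Euclidean
metric, hence complete. -/
theorem isCompleteMetric_conformalMetric [CompleteSpace E] (f : E → ℝ) (hf : ContDiff ℝ ∞ f)
    (h0 : ∀ x, 0 ≤ f x) {M : ℝ} (hM : ∀ x, f x ≤ M) :
    IsCompleteMetric (conformalMetric f hf) := by
  intro u hu
  have hc : CauchySeq u := EMetric.cauchySeq_iff.2 fun ε hε => by
    obtain ⟨N, hN⟩ := hu ε hε
    exact ⟨N, fun p hp q hq =>
      (edist_le_distance_conformalMetric f hf h0 _ _).trans_lt (hN p hp q hq)⟩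
  obtain ⟨x, hx⟩ := cauchySeq_tendsto_of_complete hc
  refine ⟨x, ?_⟩
  have hlim : Filter.Tendsto (fun p => ENNReal.ofReal (Real.exp M * ‖x - u p‖)) Filter.atTop
      (nhds 0) := by
    have h1 : Filter.Tendsto (fun p => Real.exp M * ‖x - u p‖) Filter.atTop (nhds 0) := by
      simpa using ((tendsto_const_nhds.sub hx).norm.const_mul (Real.exp M) :
        Filter.Tendsto (fun p => Real.exp M * ‖x - u p‖) Filter.atTop
          (nhds (Real.exp M * ‖x - x‖)))
    simpa using ENNReal.tendsto_ofReal h1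
  refine tendsto_of_tendsto_of_tendsto_of_le_of_le tendsto_const_nhds hlim
    (fun _ => zero_le) fun p => ?_
  have := distance_conformalMetric_le_of_bound f hf (u p) (x - u p) (M := M) fun t _ => hM _
  simpa using this

end Distance

/-! ### Curvature of conformal metrics -/

section ConformalCurvature

variable {n : ℕ} {f : EuclideanSpace ℝ (Fin n) → ℝ}

theorem ite_eq_one_apply_mul (i j : Fin n) (t : ℝ) :
    (if i = j then t else 0) = (1 : Matrix (Fin n) (Fin n) ℝ) i j * t := by
  rw [Matrix.one_apply, boole_mul]

theorem gram_conformalMetric (hf : ContDiff ℝ ∞ f) (x : EuclideanSpace ℝ (Fin n)) (i j : Fin n) :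
    gram (conformalMetric f hf) x i j = if i = j then Real.exp (2 * f x) else 0 := by
  have : gram (conformalMetric f hf) x i j = Real.exp (2 * f x) *
      inner ℝ (EuclideanSpace.single i (1 : ℝ)) (EuclideanSpace.single j (1 : ℝ)) := rfl
  rw [this, EuclideanSpace.inner_single_left]
  simp [PiLp.single_apply]

theorem gram_conformalMetric_eq_smul (hf : ContDiff ℝ ∞ f) (x : EuclideanSpace ℝ (Fin n)) :
    gram (conformalMetric f hf) x = Real.exp (2 * f x) • (1 : Matrix (Fin n) (Fin n) ℝ) := by
  ext i j
  rw [gram_conformalMetric, Matrix.smul_apply, Matrix.one_apply]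
  simp

theorem gram_conformalMetric_inv (hf : ContDiff ℝ ∞ f) (x : EuclideanSpace ℝ (Fin n))
    (i j : Fin n) :
    (gram (conformalMetric f hf) x)⁻¹ i j = if i = j then Real.exp (-(2 * f x)) else 0 := by
  have : (gram (conformalMetric f hf) x)⁻¹ =
      Real.exp (-(2 * f x)) • (1 : Matrix (Fin n) (Fin n) ℝ) := by
    apply Matrix.inv_eq_left_inv
    rw [gram_conformalMetric_eq_smul, Matrix.smul_mul, Matrix.one_mul, smul_smul, ← Real.exp_add]
    simp
  rw [this, Matrix.smul_apply, Matrix.one_apply]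
  simp

theorem sqrt_det_gram_conformalMetric (hf : ContDiff ℝ ∞ f) (x : EuclideanSpace ℝ (Fin n)) :
    √(gram (conformalMetric f hf) x).det = Real.exp (n * f x) := by
  rw [gram_conformalMetric_eq_smul, Matrix.det_smul, Matrix.det_one, mul_one, Fintype.card_fin,
    ← Real.exp_nat_mul, ← Real.exp_half]
  congr 1
  ring

theorem vol_conformalMetric (hf : ContDiff ℝ ∞ f) :
    vol (conformalMetric f hf) = volume.withDensity fun x => ENNReal.ofReal (Real.exp (n * f x)) := by
  simp only [vol, sqrt_det_gram_conformalMetric]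

theorem partialDeriv_gram_conformalMetric (hf : ContDiff ℝ ∞ f) (x : EuclideanSpace ℝ (Fin n))
    (i j l : Fin n) :
    partialDeriv i (fun y => gram (conformalMetric f hf) y j l) x =
      if j = l then Real.exp (2 * f x) * (2 * partialDeriv i f x) else 0 := by
  have hd : HasFDerivAt f (fderiv ℝ f x) x := (hf.differentiable (by simp) x).hasFDerivAt
  simp only [gram_conformalMetric, partialDeriv]
  split_ifs
  · rw [((hd.const_mul 2).exp).fderiv]
    simp
  · simp

theorem christoffel_conformalMetric (hf : ContDiff ℝ ∞ f) (x : EuclideanSpace ℝ (Fin n))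
    (k i j : Fin n) :
    christoffel (conformalMetric f hf) k i j x =
      (if k = j then partialDeriv i f x else 0) + (if k = i then partialDeriv j f x else 0)
        - (if i = j then partialDeriv k f x else 0) := by
  have h : Real.exp (-(2 * f x)) * Real.exp (2 * f x) = 1 := by
    rw [← Real.exp_add]; simp
  simp only [christoffel, gram_conformalMetric_inv, partialDeriv_gram_conformalMetric, ite_mul,
    zero_mul, Finset.sum_ite_eq, Finset.mem_univ, if_true, eq_comm (a := j) (b := k),
    eq_comm (a := i) (b := k)]
  simp only [ite_eq_one_apply_mul]
  linear_combination ((1 : Matrix (Fin n) (Fin n) ℝ) k j * partialDeriv i f x +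
    (1 : Matrix (Fin n) (Fin n) ℝ) k i * partialDeriv j f x -
    (1 : Matrix (Fin n) (Fin n) ℝ) i j * partialDeriv k f x) * h

theorem differentiable_partialDeriv (hf : ContDiff ℝ ∞ f) (i : Fin n) :
    Differentiable ℝ (partialDeriv i f) := by
  have : ContDiff ℝ 1 (fderiv ℝ f) := (contDiff_infty.1 hf 2).fderiv_right (by norm_num)
  exact (this.differentiable one_ne_zero).clm_apply (differentiable_const _)

theorem partialDeriv_comm (hf : ContDiff ℝ ∞ f) (i j : Fin n) (x : EuclideanSpace ℝ (Fin n)) :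
    partialDeriv i (partialDeriv j f) x = partialDeriv j (partialDeriv i f) x := by
  have hd : DifferentiableAt ℝ (fderiv ℝ f) x :=
    (((contDiff_infty.1 hf 2).fderiv_right (m := 1) (by norm_num)).differentiable one_ne_zero) x
  have h (i j : Fin n) : partialDeriv i (partialDeriv j f) x =
      fderiv ℝ (fderiv ℝ f) x (EuclideanSpace.single i 1) (EuclideanSpace.single j 1) := by
    have := hd.hasFDerivAt.clm_apply (hasFDerivAt_const (EuclideanSpace.single j (1 : ℝ)) x)
    rw [partialDeriv]
    change fderiv ℝ (fun y => fderiv ℝ f y (EuclideanSpace.single j 1)) x _ = _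
    rw [this.fderiv]
    simp
  rw [h, h]
  exact ((contDiff_infty.1 hf 2).contDiffAt.isSymmSndFDerivAt (by simp)) _ _

theorem partialDeriv_christoffel_conformalMetric (hf : ContDiff ℝ ∞ f)
    (x : EuclideanSpace ℝ (Fin n)) (m k i j : Fin n) :
    partialDeriv m (christoffel (conformalMetric f hf) k i j) x =
      (if k = j then partialDeriv m (partialDeriv i f) x else 0)
        + (if k = i then partialDeriv m (partialDeriv j f) x else 0)
        - (if i = j then partialDeriv m (partialDeriv k f) x else 0) := by
  have hfun : christoffel (conformalMetric f hf) k i j = fun x =>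
      (if k = j then partialDeriv i f x else 0) + (if k = i then partialDeriv j f x else 0)
        - (if i = j then partialDeriv k f x else 0) :=
    funext fun x => christoffel_conformalMetric hf x k i j
  have hd (i : Fin n) : DifferentiableAt ℝ (partialDeriv i f) x := differentiable_partialDeriv hf i x
  have hite (p : Prop) [Decidable p] (i : Fin n) :
      HasFDerivAt (fun x => if p then partialDeriv i f x else 0)
        (if p then fderiv ℝ (partialDeriv i f) x else 0) x := by
    split_ifs
    · exact (hd i).hasFDerivAt
    · exact hasFDerivAt_const _ _
  have h := ((hite (k = j) i).fun_add (hite (k = i) j)).fun_sub (hite (i = j) k)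
  rw [hfun, partialDeriv, h.fderiv]
  simp only [partialDeriv, sub_apply, add_apply]
  split_ifs <;> simp

/-- The components of the symmetric tensor `∇²f - df ⊗ df + ½ |df|² eucl`, whose Kulkarni–Nomizu
product with `-eucl` is, up to the factor `e^{2f}`, the curvature tensor of `e^{2f} eucl`. -/
noncomputable def conformalHessian (f : EuclideanSpace ℝ (Fin n) → ℝ) (x : EuclideanSpace ℝ (Fin n))
    (i j : Fin n) : ℝ :=
  partialDeriv i (partialDeriv j f) x - partialDeriv i f x * partialDeriv j f x
    + if i = j then (∑ m, partialDeriv m f x ^ 2) / 2 else 0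

theorem riemann_conformalMetric (hf : ContDiff ℝ ∞ f) (x : EuclideanSpace ℝ (Fin n))
    (l k i j : Fin n) :
    riemann (conformalMetric f hf) l k i j x =
      (if l = j then conformalHessian f x i k else 0)
        - (if l = i then conformalHessian f x j k else 0)
        - (if j = k then conformalHessian f x i l else 0)
        + (if i = k then conformalHessian f x j l else 0) := by
  have hsum (i j : Fin n) : ∑ m, christoffel (conformalMetric f hf) l i m x *
      christoffel (conformalMetric f hf) m j k x =
      partialDeriv i f x * ((if l = k then partialDeriv j f x else 0)
        + (if l = j then partialDeriv k f x else 0) - (if j = k then partialDeriv l f x else 0))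
      + (if l = i then 2 * (partialDeriv j f x * partialDeriv k f x)
          - (if j = k then ∑ m, partialDeriv m f x ^ 2 else 0) else 0)
      - partialDeriv l f x * ((if i = k then partialDeriv j f x else 0)
        + (if i = j then partialDeriv k f x else 0) - (if j = k then partialDeriv i f x else 0)) := by
    have h1 : ∑ m, partialDeriv m f x * christoffel (conformalMetric f hf) m j k x =
        2 * (partialDeriv j f x * partialDeriv k f x)
          - (if j = k then ∑ m, partialDeriv m f x ^ 2 else 0) := by
      simp only [christoffel_conformalMetric, mul_sub, mul_add, Finset.sum_sub_distrib,
        Finset.sum_add_distrib, mul_ite, mul_zero, Finset.sum_ite_eq', Finset.mem_univ, if_true]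
      split_ifs <;> simp only [pow_two, Finset.sum_const_zero] <;> ring
    simp only [christoffel_conformalMetric hf x l i, sub_mul, add_mul, Finset.sum_sub_distrib,
      Finset.sum_add_distrib, ite_mul, zero_mul, Finset.sum_ite_eq, Finset.mem_univ, if_true]
    rw [christoffel_conformalMetric, christoffel_conformalMetric, ← h1]
    split_ifs <;> simp
  rw [riemann, Finset.sum_sub_distrib, hsum i j, hsum j i,
    partialDeriv_christoffel_conformalMetric, partialDeriv_christoffel_conformalMetric]
  simp only [conformalHessian, partialDeriv_comm hf j i, eq_comm (a := j) (b := i),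
    eq_comm (a := i) (b := l), eq_comm (a := j) (b := l), ite_eq_one_apply_mul]
  ring

/-- Contraction of the Kulkarni–Nomizu product of a bilinear form with the Euclidean metric. -/
theorem sum_kulkarniNomizu (H : Fin n → Fin n → ℝ) (u v : Fin n → ℝ) :
    ∑ i, ∑ j, ∑ k, ∑ l, ((if l = j then H i k else 0) - (if l = i then H j k else 0)
        - (if j = k then H i l else 0) + (if i = k then H j l else 0)) * u i * v j * v k * u l =
      (∑ i, ∑ k, H i k * u i * v k) * (∑ j, u j * v j)
      - (∑ j, ∑ k, H j k * v j * v k) * (∑ i, u i * u i)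
      - (∑ i, ∑ l, H i l * u i * u l) * (∑ j, v j * v j)
      + (∑ j, ∑ l, H j l * v j * u l) * (∑ i, u i * v i) := by
  have h1 (i j k : Fin n) : ∑ l, ((if l = j then H i k else 0) - (if l = i then H j k else 0)
      - (if j = k then H i l else 0) + (if i = k then H j l else 0)) * u i * v j * v k * u l =
      H i k * v k * (u i * (u j * v j)) - H j k * v k * (v j * (u i * u i))
      - (if j = k then (∑ l, H i l * u l) * (u i * (v j * v k)) else 0)
      + (if i = k then (∑ l, H j l * u l) * (v j * (u i * v k)) else 0) := by
    simp only [add_mul, sub_mul, Finset.sum_add_distrib, Finset.sum_sub_distrib, ite_mul, zero_mul,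
      Finset.sum_ite_eq', Finset.mem_univ, if_true, Finset.sum_mul]
    split_ifs <;> ring_nf <;> simp
  have h2 (i j : Fin n) : ∑ k, (H i k * v k * (u i * (u j * v j))
      - H j k * v k * (v j * (u i * u i))
      - (if j = k then (∑ l, H i l * u l) * (u i * (v j * v k)) else 0)
      + (if i = k then (∑ l, H j l * u l) * (v j * (u i * v k)) else 0)) =
      (∑ k, H i k * v k) * u i * (u j * v j) - (∑ k, H j k * v k) * v j * (u i * u i)
      - (∑ l, H i l * u l) * u i * (v j * v j) + (∑ l, H j l * u l) * v j * (u i * v i) := by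
    simp only [Finset.sum_add_distrib, Finset.sum_sub_distrib, ← Finset.sum_mul,
      Finset.sum_ite_eq, Finset.mem_univ, if_true]
    ring
  simp only [h1, h2, Finset.sum_add_distrib, Finset.sum_sub_distrib, ← Finset.mul_sum,
    ← Finset.sum_mul]
  have h3 (a b : Fin n → ℝ) : ∑ i, ∑ k, H i k * a i * b k = ∑ i, (∑ k, H i k * b k) * a i := by
    simp only [Finset.sum_mul, mul_right_comm]
  rw [h3, h3, h3, h3]

/-- The curvature form when the conformal Hessian is a combination of a rank one tensor `z ⊗ z` and
the Euclidean metric, as happens for radial `f`. -/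
theorem curvatureForm_conformalMetric (hf : ContDiff ℝ ∞ f) {x : EuclideanSpace ℝ (Fin n)}
    {z : EuclideanSpace ℝ (Fin n)} {α β : ℝ}
    (h : ∀ i j, conformalHessian f x i j = α * (z i * z j) + if i = j then β else 0)
    (u v : EuclideanSpace ℝ (Fin n)) :
    curvatureForm (conformalMetric f hf) x u v = -(Real.exp (2 * f x) *
      (α * (inner ℝ z u ^ 2 * inner ℝ v v + inner ℝ z v ^ 2 * inner ℝ u u
        - 2 * inner ℝ z u * inner ℝ z v * inner ℝ u v)
      + 2 * β * (inner ℝ u u * inner ℝ v v - inner ℝ u v ^ 2))) := by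
  have hin (a b : EuclideanSpace ℝ (Fin n)) : inner ℝ a b = ∑ i, a i * b i := by
    simp [PiLp.inner_apply, mul_comm]
  have hR : curvatureForm (conformalMetric f hf) x u v = Real.exp (2 * f x) *
      ∑ i, ∑ j, ∑ k, ∑ l, riemann (conformalMetric f hf) l k i j x * u i * v j * v k * u l := by
    simp only [curvatureForm, gram_conformalMetric, ite_mul, zero_mul, Finset.sum_ite_eq,
      Finset.mem_univ, if_true, Finset.mul_sum, mul_assoc]
  have hB (a b : EuclideanSpace ℝ (Fin n)) : ∑ i, ∑ k, conformalHessian f x i k * a i * b k =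
      α * (inner ℝ z a * inner ℝ z b) + β * inner ℝ a b := by
    have h1 : ∑ i, ∑ k, α * (z i * z k) * a i * b k = α * (inner ℝ z a * inner ℝ z b) := by
      rw [hin, hin, Finset.sum_mul_sum, Finset.mul_sum]
      simp only [Finset.mul_sum]
      exact Finset.sum_congr rfl fun i _ => Finset.sum_congr rfl fun j _ => by ring
    have h2 : ∑ i, ∑ k, (if i = k then β else 0) * a i * b k = β * inner ℝ a b := by
      simp only [hin, ite_mul, zero_mul, Finset.sum_ite_eq, Finset.mem_univ, if_true,
        Finset.mul_sum, mul_assoc]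
    rw [← h1, ← h2]
    simp only [h, add_mul, Finset.sum_add_distrib]
  rw [hR]
  simp only [riemann_conformalMetric]
  rw [sum_kulkarniNomizu, hB, hB, hB, hB, ← hin, ← hin, ← hin, real_inner_comm u v]
  ring

end ConformalCurvature

/-! ### Curvature of radial conformal factors -/

section RadialCurvature

variable {n : ℕ} {f : EuclideanSpace ℝ (Fin n) → ℝ}

/-- The Gram determinant of three vectors is nonnegative. -/
theorem gramDet_nonneg {E : Type*} [NormedAddCommGroup E] [InnerProductSpace ℝ E] (z u v : E) :
    inner ℝ z u ^ 2 * inner ℝ v v + inner ℝ z v ^ 2 * inner ℝ u u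
      - 2 * inner ℝ z u * inner ℝ z v * inner ℝ u v ≤
    inner ℝ z z * (inner ℝ u u * inner ℝ v v - inner ℝ u v ^ 2) := by
  have h := (Matrix.posSemidef_gram ℝ ![z, u, v]).det_nonneg
  rw [Matrix.det_fin_three] at h
  simp only [Matrix.gram_apply, Matrix.cons_val_zero, Matrix.cons_val_one, Matrix.cons_val] at h
  rw [real_inner_comm z u, real_inner_comm z v, real_inner_comm u v] at h
  linarith

/-- The left-hand side of `gramDet_nonneg` is the square norm of `⟪z, u⟫ v - ⟪z, v⟫ u`. -/
theorem inner_plane_nonneg {E : Type*} [NormedAddCommGroup E] [InnerProductSpace ℝ E] (z u v : E) :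
    0 ≤ inner ℝ z u ^ 2 * inner ℝ v v + inner ℝ z v ^ 2 * inner ℝ u u
      - 2 * inner ℝ z u * inner ℝ z v * inner ℝ u v := by
  have h := real_inner_self_nonneg (x := inner ℝ z u • v - inner ℝ z v • u)
  rw [inner_sub_left, inner_sub_right, inner_sub_right] at h
  simp only [real_inner_smul_left, real_inner_smul_right] at h
  rw [real_inner_comm u v] at h
  linarith

theorem partialDeriv_congr {h k : EuclideanSpace ℝ (Fin n) → ℝ} {x : EuclideanSpace ℝ (Fin n)}
    (hk : h =ᶠ[𝓝 x] k) (i : Fin n) : partialDeriv i h x = partialDeriv i k x := by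
  rw [partialDeriv, partialDeriv, hk.fderiv_eq]

theorem hasFDerivAt_norm_sub_sq (x p : EuclideanSpace ℝ (Fin n)) :
    HasFDerivAt (fun y => ‖y - p‖ ^ 2) (2 • innerSL ℝ (x - p)) x := by
  simpa using ((hasFDerivAt_id x).sub_const p).norm_sq

theorem hasFDerivAt_log_norm_sub {x p : EuclideanSpace ℝ (Fin n)} (hx : x ≠ p) :
    HasFDerivAt (fun y => Real.log ‖y - p‖) ((‖x - p‖ ^ 2)⁻¹ • innerSL ℝ (x - p)) x := by
  have h0 : ‖x - p‖ ≠ 0 := norm_ne_zero_iff.2 (sub_ne_zero.2 hx)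
  -- `log ‖y - p‖` is half the logarithm of the polynomial `‖y - p‖ ^ 2`.
  have h := ((hasFDerivAt_norm_sub_sq x p).log (pow_ne_zero 2 h0)).const_mul (1 / 2 : ℝ)
  refine (h.congr_of_eventuallyEq (Eventually.of_forall fun y => ?_)).congr_fderiv ?_
  · simp only [Real.log_pow]
    push_cast
    ring
  · ext w
    simp
    ring

theorem partialDeriv_radial {ψ ψ₁ : ℝ → ℝ} (h1 : ∀ s, HasDerivAt ψ (ψ₁ s) s)
    {x p : EuclideanSpace ℝ (Fin n)} (hx : x ≠ p)
    (hf : f =ᶠ[𝓝 x] fun y => ψ (Real.log ‖y - p‖)) (i : Fin n) :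
    partialDeriv i f x = ψ₁ (Real.log ‖x - p‖) * ((‖x - p‖ ^ 2)⁻¹ * (x - p) i) := by
  have h := ((h1 _).comp_hasFDerivAt x (hasFDerivAt_log_norm_sub hx)).fderiv
  rw [Function.comp_def] at h
  rw [partialDeriv_congr hf, partialDeriv, h]
  simp [EuclideanSpace.inner_single_right]

theorem conformalHessian_radial {ψ ψ₁ ψ₂ : ℝ → ℝ} (h1 : ∀ s, HasDerivAt ψ (ψ₁ s) s)
    (h2 : ∀ s, HasDerivAt ψ₁ (ψ₂ s) s) {x p : EuclideanSpace ℝ (Fin n)} (hx : x ≠ p)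
    (hf : f =ᶠ[𝓝 x] fun y => ψ (Real.log ‖y - p‖)) (i j : Fin n) :
    conformalHessian f x i j =
      (ψ₂ (Real.log ‖x - p‖) - 2 * ψ₁ (Real.log ‖x - p‖) - ψ₁ (Real.log ‖x - p‖) ^ 2)
          * ((‖x - p‖ ^ 2)⁻¹) ^ 2 * ((x - p) i * (x - p) j)
        + if i = j then (ψ₁ (Real.log ‖x - p‖) + ψ₁ (Real.log ‖x - p‖) ^ 2 / 2) * (‖x - p‖ ^ 2)⁻¹
          else 0 := by
  have h0 : ‖x - p‖ ^ 2 ≠ 0 := pow_ne_zero 2 (norm_ne_zero_iff.2 (sub_ne_zero.2 hx))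
  have hev : partialDeriv j f =ᶠ[𝓝 x]
      fun y => ψ₁ (Real.log ‖y - p‖) * ((‖y - p‖ ^ 2)⁻¹ * (y - p) j) := by
    filter_upwards [hf.eventuallyEq_nhds, isOpen_ne.mem_nhds hx] with y hy hyp
    exact partialDeriv_radial h1 hyp hy j
  have hcoord : HasFDerivAt (fun y : EuclideanSpace ℝ (Fin n) => (y - p) j)
      (EuclideanSpace.proj j : EuclideanSpace ℝ (Fin n) →L[ℝ] ℝ) x := by
    simpa using ((EuclideanSpace.proj j : EuclideanSpace ℝ (Fin n) →L[ℝ] ℝ).hasFDerivAt).sub_const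
      (p j)
  have hinv := (hasDerivAt_inv h0).comp_hasFDerivAt x (hasFDerivAt_norm_sub_sq x p)
  have hD := ((h2 _).comp_hasFDerivAt x (hasFDerivAt_log_norm_sub hx)).mul (hinv.mul hcoord)
  have hij : partialDeriv i (partialDeriv j f) x =
      ψ₁ (Real.log ‖x - p‖) * ((‖x - p‖ ^ 2)⁻¹ * (if i = j then 1 else 0)
        - 2 * ((‖x - p‖ ^ 2)⁻¹) ^ 2 * (x - p) i * (x - p) j)
      + ψ₂ (Real.log ‖x - p‖) * ((‖x - p‖ ^ 2)⁻¹) ^ 2 * (x - p) i * (x - p) j := by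
    rw [partialDeriv_congr hev, partialDeriv]
    have := hD.fderiv
    simp only [Pi.mul_def, Function.comp_def] at this
    rw [this]
    simp [EuclideanSpace.inner_single_right, PiLp.single_apply, eq_comm (a := j) (b := i)]
    split_ifs <;> ring
  have hsum : ∑ m, partialDeriv m f x ^ 2 = ψ₁ (Real.log ‖x - p‖) ^ 2 * (‖x - p‖ ^ 2)⁻¹ := by
    simp only [partialDeriv_radial h1 hx hf, mul_pow, ← Finset.mul_sum]
    rw [← EuclideanSpace.real_norm_sq_eq]
    field_simp
  rw [conformalHessian, hij, hsum, partialDeriv_radial h1 hx hf, partialDeriv_radial h1 hx hf]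
  split_ifs <;> ring

/-- For a radial conformal factor `ψ (log r)` with logarithmic slope in `[-2, 0]`, planes orthogonal
to the radius are nonnegatively curved, and the radial planes have curvature
`-e^{-2f} ψ'' / r²`. -/
theorem sigmaMinus_radial_le {ψ ψ₁ ψ₂ : ℝ → ℝ} (h1 : ∀ s, HasDerivAt ψ (ψ₁ s) s)
    (h2 : ∀ s, HasDerivAt ψ₁ (ψ₂ s) s) (hneg : ∀ s, ψ₁ s ≤ 0) (hge : ∀ s, -2 ≤ ψ₁ s)
    (hfs : ContDiff ℝ ∞ f) {x p : EuclideanSpace ℝ (Fin n)} (hx : x ≠ p)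
    (hf : f =ᶠ[𝓝 x] fun y => ψ (Real.log ‖y - p‖)) :
    sigmaMinus (conformalMetric f hfs) x ≤ ENNReal.ofReal
      (Real.exp (-(2 * f x)) * (max (ψ₂ (Real.log ‖x - p‖)) 0 * (‖x - p‖ ^ 2)⁻¹)) := by
  refine iSup_le fun u => iSup_le fun v => iSup_le fun _ => ENNReal.ofReal_le_ofReal ?_
  have h0 : 0 < ‖x - p‖ ^ 2 := pow_pos (norm_pos_iff.2 (sub_ne_zero.2 hx)) 2
  have hin (a b : EuclideanSpace ℝ (Fin n)) : (conformalMetric f hfs).inner x a b =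
      Real.exp (2 * f x) * inner ℝ a b := rfl
  rw [sectionalCurvature, curvatureForm_conformalMetric hfs
    (conformalHessian_radial h1 h2 hx hf), hin, hin, hin, neg_div, neg_neg]
  -- With `D` the squared area of `u ∧ v`, the number `T / (‖x - p‖ ^ 2 * D) ∈ [0, 1]` is the squared
  -- length of the projection of the unit radial vector to the plane.
  have hT0 := inner_plane_nonneg (x - p) u v
  have hT := gramDet_nonneg (x - p) u v
  rw [real_inner_self_eq_norm_sq (x - p)] at hT
  set T := inner ℝ (x - p) u ^ 2 * inner ℝ v v + inner ℝ (x - p) v ^ 2 * inner ℝ u u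
      - 2 * inner ℝ (x - p) u * inner ℝ (x - p) v * inner ℝ u v
  have hD : 0 ≤ inner ℝ u u * inner ℝ v v - inner ℝ u v ^ 2 :=
    nonneg_of_mul_nonneg_right (hT0.trans hT) h0
  have hexp : Real.exp (2 * f x) * Real.exp (-(2 * f x)) = 1 := by rw [← Real.exp_add]; simp
  have hpos := Real.exp_pos (2 * f x)
  have hn' := Real.exp_pos (-(2 * f x))
  set D := inner ℝ u u * inner ℝ v v - inner ℝ u v ^ 2
  set e := Real.exp (2 * f x)
  set e' := Real.exp (-(2 * f x))
  set s := Real.log ‖x - p‖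
  set q := ‖x - p‖ ^ 2
  have hden : e * inner ℝ u u * (e * inner ℝ v v) - (e * inner ℝ u v) ^ 2 = e ^ 2 * D := by
    simp only [D]; ring
  rw [hden]
  refine div_le_of_le_mul₀ (by positivity) (by positivity) ?_
  have hqq : q⁻¹ * q = 1 := inv_mul_cancel₀ h0.ne'
  have hq := inv_pos.2 h0
  have key : (ψ₂ s - 2 * ψ₁ s - ψ₁ s ^ 2) * q⁻¹ ^ 2 * T
      + 2 * ((ψ₁ s + ψ₁ s ^ 2 / 2) * q⁻¹) * D ≤ max (ψ₂ s) 0 * q⁻¹ * D := by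
    have e1 : 0 ≤ D - q⁻¹ * T := by
      have := mul_le_mul_of_nonneg_left hT hq.le
      rw [← mul_assoc, hqq, one_mul] at this
      linarith
    have e2 : (2 * ψ₁ s + ψ₁ s ^ 2) ≤ 0 := by nlinarith [hneg s, hge s]
    have e3 : ψ₂ s * (q⁻¹ * T) ≤ max (ψ₂ s) 0 * D :=
      (mul_le_mul_of_nonneg_right (le_max_left _ _) (by positivity)).trans
        (mul_le_mul_of_nonneg_left (by linarith) (le_max_right _ _))
    have e4 := mul_nonpos_of_nonpos_of_nonneg e2 e1
    have e5 : ψ₂ s * (q⁻¹ * T) + (2 * ψ₁ s + ψ₁ s ^ 2) * (D - q⁻¹ * T) ≤ max (ψ₂ s) 0 * D := by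
      linarith
    have := mul_le_mul_of_nonneg_left e5 hq.le
    nlinarith [this]
  calc _ ≤ e * (max (ψ₂ s) 0 * q⁻¹ * D) := by gcongr
    _ = e * (e * e') * (max (ψ₂ s) 0 * q⁻¹ * D) := by rw [hexp, mul_one]
    _ = _ := by ring

theorem sigmaMinus_eq_zero_of_eventually_const (hn : 1 ≤ n) (hfs : ContDiff ℝ ∞ f)
    {x : EuclideanSpace ℝ (Fin n)} {c : ℝ} (hf : f =ᶠ[𝓝 x] fun _ => c) :
    sigmaMinus (conformalMetric f hfs) x = 0 := by
  have : Nonempty (Fin n) := ⟨⟨0, hn⟩⟩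
  -- A constant is radial with zero slope about any other point.
  obtain ⟨p, hp⟩ := exists_ne x
  have h := sigmaMinus_radial_le (ψ := fun _ => c) (ψ₁ := fun _ => 0) (ψ₂ := fun _ => 0)
    (fun s => hasDerivAt_const s c) (fun s => hasDerivAt_const s 0) (fun _ => le_rfl)
    (fun _ => by norm_num) hfs hp.symm hf
  simpa using h

end RadialCurvature

/-! ### The logarithmic profile of a bubble -/

section Profile

theorem deriv_smoothTransition_eq_zero {t : ℝ} (ht : t ∉ Icc (0 : ℝ) 1) :
    deriv Real.smoothTransition t = 0 := by
  rcases not_and_or.1 ht with h | h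
  · have : Real.smoothTransition =ᶠ[𝓝 t] fun _ => 0 := by
      filter_upwards [Iio_mem_nhds (not_le.1 h)] with s hs
      exact Real.smoothTransition.zero_of_nonpos hs.le
    rw [this.deriv_eq, deriv_const]
  · have : Real.smoothTransition =ᶠ[𝓝 t] fun _ => 1 := by
      filter_upwards [Ioi_mem_nhds (not_le.1 h)] with s hs
      exact Real.smoothTransition.one_of_one_le hs.le
    rw [this.deriv_eq, deriv_const]

theorem exists_deriv_smoothTransition_le :
    ∃ K : ℝ, 0 < K ∧ ∀ t, deriv Real.smoothTransition t ≤ K := by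
  have hc : Continuous (deriv Real.smoothTransition) :=
    (Real.smoothTransition.contDiff (n := 1)).continuous_deriv le_rfl
  obtain ⟨K, hK⟩ := isCompact_Icc.bddAbove_image (f := deriv Real.smoothTransition)
    (hc.continuousOn (s := Icc (0 : ℝ) 1))
  refine ⟨max K 1, by positivity, fun t => ?_⟩
  by_cases ht : t ∈ Icc (0 : ℝ) 1
  · exact (hK (mem_image_of_mem _ ht)).trans (le_max_left _ _)
  · rw [deriv_smoothTransition_eq_zero ht]
    positivity

theorem deriv_smoothTransition_nonneg (t : ℝ) : 0 ≤ deriv Real.smoothTransition t :=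
  Real.smoothTransition.monotone.deriv_nonneg

/-- The logarithmic slope of a bubble, for `0 < ℓ` and `b ≤ -1`: it vanishes outside `[b, ℓ]`, falls to
`-2` on `[b, b + 1]` (the cap), equals `-2` on `[b + 1, 0]`, and rises from `-2` to `0` across `[0, ℓ]`
(the neck). -/
noncomputable def bubbleSlope (ℓ b s : ℝ) : ℝ :=
  -2 * Real.smoothTransition ((ℓ - s) / ℓ) * Real.smoothTransition (s - b)

/-- The primitive of `bubbleSlope` that vanishes at `ℓ`. -/
noncomputable def bubbleProfile (ℓ b s : ℝ) : ℝ := ∫ t in ℓ..s, bubbleSlope ℓ b t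

/-- The value at `0` of `bubbleProfile ℓ b` for `b ≤ -1`. -/
noncomputable def neckHeight (ℓ : ℝ) : ℝ := ∫ t in ℓ..0, -2 * Real.smoothTransition ((ℓ - t) / ℓ)

variable {ℓ b : ℝ}

theorem contDiff_bubbleSlope (ℓ b : ℝ) : ContDiff ℝ ∞ (bubbleSlope ℓ b) := by
  unfold bubbleSlope
  have h : ContDiff ℝ ∞ Real.smoothTransition := Real.smoothTransition.contDiff
  exact (contDiff_const.mul (h.comp (by fun_prop))).mul (h.comp (by fun_prop))

theorem hasDerivAt_bubbleProfile (ℓ b s : ℝ) :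
    HasDerivAt (bubbleProfile ℓ b) (bubbleSlope ℓ b s) s :=
  (contDiff_bubbleSlope ℓ b).continuous.integral_hasStrictDerivAt ℓ s |>.hasDerivAt

theorem hasDerivAt_bubbleSlope (ℓ b s : ℝ) :
    HasDerivAt (bubbleSlope ℓ b) (deriv (bubbleSlope ℓ b) s) s :=
  ((contDiff_bubbleSlope ℓ b).differentiable (by simp) s).hasDerivAt

theorem contDiff_bubbleProfile (ℓ b : ℝ) : ContDiff ℝ ∞ (bubbleProfile ℓ b) := by
  rw [contDiff_infty_iff_deriv]
  refine ⟨fun s => (hasDerivAt_bubbleProfile ℓ b s).differentiableAt, ?_⟩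
  rw [show deriv (bubbleProfile ℓ b) = bubbleSlope ℓ b from
    funext fun s => (hasDerivAt_bubbleProfile ℓ b s).deriv]
  exact contDiff_bubbleSlope ℓ b

theorem bubbleSlope_nonpos (ℓ b s : ℝ) : bubbleSlope ℓ b s ≤ 0 := by
  have := mul_nonneg (Real.smoothTransition.nonneg ((ℓ - s) / ℓ))
    (Real.smoothTransition.nonneg (s - b))
  rw [bubbleSlope]
  linarith

theorem neg_two_le_bubbleSlope (ℓ b s : ℝ) : -2 ≤ bubbleSlope ℓ b s := by
  have := mul_le_one₀ (Real.smoothTransition.le_one ((ℓ - s) / ℓ))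
    (Real.smoothTransition.nonneg (s - b)) (Real.smoothTransition.le_one (s - b))
  rw [bubbleSlope]
  linarith

theorem antitone_bubbleProfile (ℓ b : ℝ) : Antitone (bubbleProfile ℓ b) :=
  antitone_of_hasDerivAt_nonpos (hasDerivAt_bubbleProfile ℓ b) (bubbleSlope_nonpos ℓ b)

theorem bubbleProfile_of_ge (hℓ : 0 < ℓ) {s : ℝ} (hs : ℓ ≤ s) : bubbleProfile ℓ b s = 0 := by
  rw [bubbleProfile, intervalIntegral.integral_congr (g := fun _ => (0 : ℝ))]
  · simp
  · intro t ht
    rw [uIcc_of_le hs] at ht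
    have : Real.smoothTransition ((ℓ - t) / ℓ) = 0 :=
      Real.smoothTransition.zero_of_nonpos (div_nonpos_of_nonpos_of_nonneg (by linarith [ht.1]) hℓ.le)
    simp [bubbleSlope, this]

theorem bubbleProfile_nonneg (hℓ : 0 < ℓ) (s : ℝ) : 0 ≤ bubbleProfile ℓ b s := by
  rw [← bubbleProfile_of_ge (b := b) hℓ (le_max_right s ℓ)]
  exact antitone_bubbleProfile ℓ b (le_max_left _ _)

theorem bubbleProfile_sub (ℓ b s t : ℝ) :
    bubbleProfile ℓ b t - bubbleProfile ℓ b s = ∫ τ in s..t, bubbleSlope ℓ b τ := by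
  have h (u v : ℝ) : IntervalIntegrable (bubbleSlope ℓ b) volume u v :=
    (contDiff_bubbleSlope ℓ b).continuous.intervalIntegrable u v
  exact intervalIntegral.integral_interval_sub_left (h _ _) (h _ _)

theorem bubbleProfile_of_le {s : ℝ} (hs : s ≤ b) : bubbleProfile ℓ b s = bubbleProfile ℓ b b := by
  rw [← sub_eq_zero, ← neg_eq_zero, neg_sub, bubbleProfile_sub,
    intervalIntegral.integral_congr (g := fun _ => (0 : ℝ))]
  · simp
  · intro t ht
    rw [uIcc_of_le hs] at ht
    have : Real.smoothTransition (t - b) = 0 :=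
      Real.smoothTransition.zero_of_nonpos (by linarith [ht.2])
    simp [bubbleSlope, this]

theorem bubbleProfile_le_max (ℓ b s : ℝ) : bubbleProfile ℓ b s ≤ bubbleProfile ℓ b b := by
  rcases le_total s b with h | h
  · exact (bubbleProfile_of_le h).le
  · exact antitone_bubbleProfile ℓ b h

theorem bubbleProfile_zero (hℓ : 0 < ℓ) (hb : b ≤ -1) : bubbleProfile ℓ b 0 = neckHeight ℓ := by
  refine intervalIntegral.integral_congr fun t ht => ?_
  rw [uIcc_of_ge hℓ.le] at ht
  have : Real.smoothTransition (t - b) = 1 :=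
    Real.smoothTransition.one_of_one_le (by linarith [ht.1])
  simp [bubbleSlope, this]

theorem bubbleProfile_of_mem (hℓ : 0 < ℓ) (hb : b ≤ -1) {s : ℝ} (h1 : b + 1 ≤ s) (h2 : s ≤ 0) :
    bubbleProfile ℓ b s = neckHeight ℓ - 2 * s := by
  have h := bubbleProfile_sub ℓ b s 0
  rw [intervalIntegral.integral_congr (g := fun _ => (-2 : ℝ)),
    bubbleProfile_zero hℓ hb] at h
  · simp at h
    linarith
  · intro t ht
    rw [uIcc_of_le h2] at ht
    have e1 : Real.smoothTransition (t - b) = 1 :=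
      Real.smoothTransition.one_of_one_le (by linarith [ht.1])
    have e2 : Real.smoothTransition ((ℓ - t) / ℓ) = 1 :=
      Real.smoothTransition.one_of_one_le (by rw [le_div_iff₀ hℓ]; linarith [ht.2])
    simp [bubbleSlope, e1, e2]

/-- The slope of the profile is at least `-2`. -/
theorem bubbleProfile_sub_le {s t : ℝ} (hst : s ≤ t) :
    bubbleProfile ℓ b s ≤ bubbleProfile ℓ b t + 2 * (t - s) := by
  have h : Monotone fun s => bubbleProfile ℓ b s + 2 * s := by
    refine monotone_of_hasDerivAt_nonneg (f' := fun s => bubbleSlope ℓ b s + 2 * 1)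
      (fun s => (hasDerivAt_bubbleProfile ℓ b s).add ((hasDerivAt_id s).const_mul 2)) fun s => ?_
    have := neg_two_le_bubbleSlope ℓ b s
    simp only [Pi.zero_apply]
    linarith
  have := h hst
  simp only at this
  linarith

theorem neckHeight_le (hℓ : 0 < ℓ) : neckHeight ℓ ≤ 2 * ℓ := by
  have h := bubbleProfile_sub_le (ℓ := ℓ) (b := -1) hℓ.le
  rw [bubbleProfile_zero hℓ le_rfl, bubbleProfile_of_ge hℓ le_rfl] at h
  linarith

/-- The slope increases only across the neck `[0, ℓ]`, and there at a rate of order `1 / ℓ`. -/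
theorem deriv_bubbleSlope_le {K : ℝ} (hK : ∀ t, deriv Real.smoothTransition t ≤ K) (hℓ : 0 < ℓ)
    (s : ℝ) : max (deriv (bubbleSlope ℓ b) s) 0 ≤ if s ∈ Icc 0 ℓ then 2 * K / ℓ else 0 := by
  have hK0 : 0 ≤ K := (deriv_smoothTransition_nonneg 0).trans (hK 0)
  have hd (t : ℝ) : HasDerivAt Real.smoothTransition (deriv Real.smoothTransition t) t :=
    ((Real.smoothTransition.contDiff (n := 1)).differentiable one_ne_zero t).hasDerivAt
  have h1 : HasDerivAt (fun s => Real.smoothTransition ((ℓ - s) / ℓ))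
      (deriv Real.smoothTransition ((ℓ - s) / ℓ) * (-1 / ℓ)) s :=
    (hd _).comp s (((hasDerivAt_id s).const_sub ℓ).div_const ℓ)
  have h2 : HasDerivAt (fun s => Real.smoothTransition (s - b))
      (deriv Real.smoothTransition (s - b) * 1) s :=
    (hd _).comp s ((hasDerivAt_id s).sub_const b)
  have h3 : deriv (bubbleSlope ℓ b) s = 2 / ℓ * (deriv Real.smoothTransition ((ℓ - s) / ℓ)
      * Real.smoothTransition (s - b))
      - 2 * (Real.smoothTransition ((ℓ - s) / ℓ) * deriv Real.smoothTransition (s - b)) := by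
    have h : deriv (bubbleSlope ℓ b) s = _ := ((h1.const_mul (-2)).fun_mul h2).deriv
    rw [h]
    ring
  have h4 : 0 ≤ Real.smoothTransition ((ℓ - s) / ℓ) * deriv Real.smoothTransition (s - b) :=
    mul_nonneg (Real.smoothTransition.nonneg _) (deriv_smoothTransition_nonneg _)
  split_ifs with h
  · refine max_le ?_ (by positivity)
    have h5 : deriv Real.smoothTransition ((ℓ - s) / ℓ) * Real.smoothTransition (s - b) ≤ K :=
      (mul_le_of_le_one_right (deriv_smoothTransition_nonneg _)
        (Real.smoothTransition.le_one _)).trans (hK _)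
    have h6 := mul_le_mul_of_nonneg_left h5 (by positivity : 0 ≤ 2 / ℓ)
    rw [h3, mul_div_right_comm]
    linarith
  · refine max_le ?_ le_rfl
    have h7 : (ℓ - s) / ℓ ∉ Icc (0 : ℝ) 1 := by
      rintro ⟨ha, hb⟩
      rw [div_le_one hℓ] at hb
      rw [le_div_iff₀ hℓ] at ha
      exact h ⟨by linarith, by linarith⟩
    rw [h3, deriv_smoothTransition_eq_zero h7]
    linarith

end Profile

/-! ### A single bubble -/

section Bubble

variable {E : Type*} [NormedAddCommGroup E] {ℓ b : ℝ}

/-- The conformal exponent of a single bubble centred at the origin: the radial function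
`bubbleProfile (log ‖x‖)`. Truncating the norm below at `exp b`, where the profile is constant
anyway, removes the singularity of the logarithm. -/
noncomputable def bubble (ℓ b : ℝ) (x : E) : ℝ :=
  bubbleProfile ℓ b (Real.log (max ‖x‖ (Real.exp b)))

theorem bubble_of_ne {x : E} (hx : x ≠ 0) : bubble ℓ b x = bubbleProfile ℓ b (Real.log ‖x‖) := by
  rw [bubble]
  rcases le_total (Real.exp b) ‖x‖ with h | h
  · rw [max_eq_left h]
  · rw [max_eq_right h, Real.log_exp,
      bubbleProfile_of_le ((Real.log_le_iff_le_exp (norm_pos_iff.2 hx)).2 h)]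

theorem bubble_of_le {x : E} (hx : ‖x‖ ≤ Real.exp b) : bubble ℓ b x = bubbleProfile ℓ b b := by
  rw [bubble, max_eq_right hx, Real.log_exp]

theorem contDiff_bubble [InnerProductSpace ℝ E] (ℓ b : ℝ) : ContDiff ℝ ∞ (bubble ℓ b : E → ℝ) := by
  refine contDiff_iff_contDiffAt.2 fun x => ?_
  by_cases hx : x = 0
  · have : (bubble ℓ b : E → ℝ) =ᶠ[𝓝 x] fun _ => bubbleProfile ℓ b b := by
      filter_upwards [Metric.ball_mem_nhds x (Real.exp_pos b)] with y hy
      rw [hx, mem_ball_zero_iff] at hy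
      exact bubble_of_le hy.le
    exact contDiffAt_const.congr_of_eventuallyEq this
  · have : (bubble ℓ b : E → ℝ) =ᶠ[𝓝 x] fun y => bubbleProfile ℓ b (Real.log ‖y‖) := by
      filter_upwards [isOpen_ne.mem_nhds hx] with y hy
      exact bubble_of_ne hy
    refine ContDiffAt.congr_of_eventuallyEq ?_ this
    exact (contDiff_bubbleProfile ℓ b).contDiffAt.comp x
      ((contDiffAt_norm ℝ hx).log (norm_ne_zero_iff.2 hx))

theorem bubble_nonneg (hℓ : 0 < ℓ) (x : E) : 0 ≤ bubble ℓ b x := bubbleProfile_nonneg hℓ _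

theorem bubble_le_max (x : E) : bubble ℓ b x ≤ bubbleProfile ℓ b b := bubbleProfile_le_max ℓ b _

theorem bubble_eq_zero (hℓ : 0 < ℓ) {x : E} (hx : Real.exp ℓ ≤ ‖x‖) : bubble ℓ b x = 0 :=
  bubbleProfile_of_ge hℓ <| (Real.le_log_iff_exp_le (lt_max_of_lt_right (Real.exp_pos b))).2
    (hx.trans (le_max_left _ _))

/-- On the ball of radius `e^(b + 1)`, which is the cap of the bubble, the conformal factor `e^f` is at
least of order `e^(neckHeight ℓ - 2 b)`, so that the size of the cap is of order
`e^(neckHeight ℓ - b)`. -/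
theorem le_bubble (hℓ : 0 < ℓ) (hb : b ≤ -1) {x : E} (hx : ‖x‖ ≤ Real.exp (b + 1)) :
    neckHeight ℓ - 2 * (b + 1) ≤ bubble ℓ b x := by
  rw [← bubbleProfile_of_mem hℓ hb le_rfl (by linarith)]
  refine antitone_bubbleProfile ℓ b
    ((Real.log_le_iff_le_exp (lt_max_of_lt_right (Real.exp_pos b))).2 (max_le hx ?_))
  exact Real.exp_le_exp.2 (by linarith)

/-- The conformal factor of a bubble is dominated by a constant plus that of a round sphere. The bound
is chosen for its explicit radial primitive. -/
theorem exp_bubble_le (hℓ : 0 < ℓ) (hb : b ≤ -1) (x : E) :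
    Real.exp (bubble ℓ b x) ≤
      Real.exp (neckHeight ℓ) * (1 + 2 / (‖x‖ ^ 2 + Real.exp b ^ 2)) := by
  set m := max ‖x‖ (Real.exp b)
  have hbpos := Real.exp_pos b
  have hmpos : 0 < m := lt_max_of_lt_right hbpos
  rcases le_total 0 (Real.log m) with h | h
  · have : bubble ℓ b x ≤ neckHeight ℓ := by
      rw [← bubbleProfile_zero hℓ hb]
      exact antitone_bubbleProfile ℓ b h
    refine (Real.exp_le_exp.2 this).trans (le_mul_of_one_le_right (Real.exp_pos _).le ?_)
    have : 0 ≤ 2 / (‖x‖ ^ 2 + Real.exp b ^ 2) := by positivity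
    linarith
  · -- The slope is at least `-2`, so `f ≤ neckHeight ℓ - 2 log m` inside the unit sphere.
    have h1 : bubble ℓ b x ≤ neckHeight ℓ + 2 * (0 - Real.log m) := by
      rw [← bubbleProfile_zero hℓ hb]
      exact bubbleProfile_sub_le h
    have h2 : Real.exp (neckHeight ℓ + 2 * (0 - Real.log m)) =
        Real.exp (neckHeight ℓ) * (m ^ 2)⁻¹ := by
      rw [Real.exp_add, zero_sub, mul_neg, Real.exp_neg, two_mul, Real.exp_add,
        Real.exp_log hmpos, pow_two]
    refine (Real.exp_le_exp.2 h1).trans (h2.trans_le (mul_le_mul_of_nonneg_left ?_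
      (Real.exp_pos _).le))
    have h3 : ‖x‖ ^ 2 + Real.exp b ^ 2 ≤ 2 * m ^ 2 := by
      have e1 := pow_le_pow_left₀ (norm_nonneg x) (le_max_left ‖x‖ (Real.exp b)) 2
      have e2 := pow_le_pow_left₀ hbpos.le (le_max_right ‖x‖ (Real.exp b)) 2
      linarith
    have h4 : (m ^ 2)⁻¹ ≤ 2 / (‖x‖ ^ 2 + Real.exp b ^ 2) := by
      rw [inv_eq_one_div, div_le_div_iff₀ (by positivity) (by positivity)]
      linarith
    linarith

/-- Bound for the length of a segment starting at the centre of a bubble. The second term is the size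
`e^(neckHeight ℓ - b)` of the cap, up to the factor `π`. -/
theorem lintegral_exp_bubble_le [NormedSpace ℝ E] (hℓ : 0 < ℓ) (hb : b ≤ -1) (v : E) :
    ∫⁻ t in Icc (0 : ℝ) 1, ENNReal.ofReal (Real.exp (bubble ℓ b (t • v))) * ‖v‖ₑ ≤
      ENNReal.ofReal (Real.exp (neckHeight ℓ) * (‖v‖ + Real.pi / Real.exp b)) := by
  set A := Real.exp (neckHeight ℓ)
  set a := Real.exp b
  set d := ‖v‖
  have hapos : 0 < a := Real.exp_pos b
  have hA : 0 < A := Real.exp_pos _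
  have hd0 : 0 ≤ d := norm_nonneg v
  let F : ℝ → ℝ := fun t => A * (t * d + 2 / a * Real.arctan (t * (d / a)))
  let F' : ℝ → ℝ := fun t => A * (1 + 2 / (t ^ 2 * d ^ 2 + a ^ 2)) * d
  have hF (t : ℝ) : HasDerivAt F (F' t) t := by
    have h1 : HasDerivAt (fun t : ℝ => t * d) d t := by simpa using (hasDerivAt_id t).mul_const d
    have h2 : HasDerivAt (fun t : ℝ => t * (d / a)) (d / a) t := by
      simpa using (hasDerivAt_id t).mul_const (d / a)
    refine ((h1.add ((h2.arctan).const_mul (2 / a))).const_mul A).congr_deriv ?_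
    have : 1 + (t * (d / a)) ^ 2 = (t ^ 2 * d ^ 2 + a ^ 2) / a ^ 2 := by field_simp; ring
    rw [this]
    have h3 : t ^ 2 * d ^ 2 + a ^ 2 ≠ 0 := by positivity
    simp only [F']
    field_simp
  have hcont : Continuous F' := by
    have : ∀ t : ℝ, t ^ 2 * d ^ 2 + a ^ 2 ≠ 0 := fun t => by positivity
    fun_prop (disch := assumption)
  have hint : ∫ t in (0 : ℝ)..1, F' t = F 1 - F 0 :=
    intervalIntegral.integral_eq_sub_of_hasDerivAt (fun t _ => hF t) (hcont.intervalIntegrable _ _)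
  have hF' (t : ℝ) : 0 ≤ F' t := by positivity
  calc _ ≤ ∫⁻ t in Icc (0 : ℝ) 1, ENNReal.ofReal (F' t) := by
        refine lintegral_mono fun t => ?_
        rw [← ofReal_norm v, ← ENNReal.ofReal_mul (Real.exp_pos _).le]
        refine ENNReal.ofReal_le_ofReal (mul_le_mul_of_nonneg_right ?_ hd0)
        refine (exp_bubble_le hℓ hb (t • v)).trans_eq ?_
        rw [norm_smul, mul_pow, Real.norm_eq_abs, sq_abs]
    _ = ENNReal.ofReal (∫ t in (0 : ℝ)..1, F' t) := by
        rw [intervalIntegral.integral_of_le zero_le_one, ← restrict_Ioc_eq_restrict_Icc]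
        symm
        exact ofReal_integral_eq_lintegral_ofReal (hcont.integrableOn_Icc.mono_set Ioc_subset_Icc_self)
          (Eventually.of_forall hF')
    _ ≤ _ := by
        refine ENNReal.ofReal_le_ofReal ?_
        rw [hint]
        have h1 : Real.arctan (1 * (d / a)) ≤ Real.pi / 2 := (Real.arctan_lt_pi_div_two _).le
        have h2 : 2 / a * Real.arctan (1 * (d / a)) ≤ Real.pi / a := by
          refine (mul_le_mul_of_nonneg_left h1 (by positivity)).trans_eq ?_
          field_simp
        simp only [F]
        rw [zero_mul, zero_mul, Real.arctan_zero, mul_zero, add_zero, mul_zero, sub_zero]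
        refine mul_le_mul_of_nonneg_left ?_ hA.le
        linarith

end Bubble

/-! ### A scale-invariant integral over an annulus -/

section AnnulusIntegral

/-- The integral of `‖x‖ ^ (-n)` over an annulus is proportional to the logarithm of the ratio of the
radii. -/
theorem lintegral_annulus_inv_pow {n : ℕ} (hn : 1 ≤ n) {ℓ c : ℝ} (hℓ : 0 < ℓ) (hc : 0 ≤ c) :
    ∫⁻ x : EuclideanSpace ℝ (Fin n), ENNReal.ofReal
        ((Icc (1 : ℝ) (Real.exp ℓ)).indicator (fun r => c * (r ^ n)⁻¹) ‖x‖) =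
      ENNReal.ofReal
        (n * (volume : Measure (EuclideanSpace ℝ (Fin n))).real (Metric.ball 0 1) * (c * ℓ)) := by
  have : Nonempty (Fin n) := ⟨⟨0, hn⟩⟩
  have : Nontrivial (EuclideanSpace ℝ (Fin n)) := inferInstance
  set G : ℝ → ℝ := (Icc (1 : ℝ) (Real.exp ℓ)).indicator fun r => c * (r ^ n)⁻¹
  have hG0 (r : ℝ) : 0 ≤ G r := by
    refine indicator_nonneg (fun r hr => ?_) r
    have := hr.1
    positivity
  have hpow : (fun r : ℝ => r ^ (n - 1) • G r) =
      (Icc (1 : ℝ) (Real.exp ℓ)).indicator fun r => c * r⁻¹ := by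
    ext r
    by_cases hr : r ∈ Icc (1 : ℝ) (Real.exp ℓ)
    · have h0 : r ≠ 0 := by linarith [hr.1]
      simp only [G, indicator_of_mem hr, smul_eq_mul]
      have : r ^ n = r ^ (n - 1) * r := by rw [← pow_succ, Nat.sub_add_cancel hn]
      rw [this]
      field_simp
    · simp [G, indicator_of_notMem hr]
  have h1 : 1 ≤ Real.exp ℓ := Real.one_le_exp hℓ.le
  have hcont : ContinuousOn (fun r : ℝ => c * r⁻¹) (Icc 1 (Real.exp ℓ)) :=
    continuousOn_const.mul (continuousOn_inv₀.mono fun r hr => by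
      have := hr.1
      simp
      linarith)
  have hsub : Icc (1 : ℝ) (Real.exp ℓ) ⊆ Ioi 0 := fun r hr => lt_of_lt_of_le one_pos hr.1
  have hi : IntegrableOn (fun r : ℝ => r ^ (n - 1) • G r) (Ioi 0) := by
    rw [hpow]
    exact ((integrable_indicator_iff measurableSet_Icc).2 hcont.integrableOn_Icc).integrableOn
  have hint : Integrable (fun x : EuclideanSpace ℝ (Fin n) => G ‖x‖) := by
    rw [integrable_fun_norm_addHaar, finrank_euclideanSpace_fin]
    exact hi
  rw [← ofReal_integral_eq_lintegral_ofReal hint (Eventually.of_forall fun x => hG0 _),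
    integral_fun_norm_addHaar, finrank_euclideanSpace_fin, hpow,
    setIntegral_indicator measurableSet_Icc, inter_eq_self_of_subset_right hsub,
    integral_Icc_eq_integral_Ioc, ← intervalIntegral.integral_of_le h1,
    intervalIntegral.integral_const_mul, integral_inv_of_pos one_pos (Real.exp_pos ℓ), div_one,
    Real.log_exp, nsmul_eq_mul, smul_eq_mul, mul_assoc]

end AnnulusIntegral

/-! ### Superposition of disjoint bubbles -/

section BubbleSum

variable {n N : ℕ} {ℓ b : ℝ} {p : ℕ → EuclideanSpace ℝ (Fin n)}

/-- The superposition of `N` bubbles with centres `p 0, …, p (N - 1)`. -/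
noncomputable def bubbleSum (ℓ b : ℝ) (N : ℕ) (p : ℕ → EuclideanSpace ℝ (Fin n))
    (x : EuclideanSpace ℝ (Fin n)) : ℝ :=
  ∑ i ∈ Finset.range N, bubble ℓ b (x - p i)

theorem contDiff_bubbleSum (ℓ b : ℝ) (N : ℕ) (p : ℕ → EuclideanSpace ℝ (Fin n)) :
    ContDiff ℝ ∞ (bubbleSum ℓ b N p) :=
  ContDiff.sum fun _ _ => (contDiff_bubble ℓ b).comp (contDiff_id.sub contDiff_const)

theorem bubbleSum_nonneg (hℓ : 0 < ℓ) (x : EuclideanSpace ℝ (Fin n)) : 0 ≤ bubbleSum ℓ b N p x :=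
  Finset.sum_nonneg fun _ _ => bubble_nonneg hℓ _

theorem bubbleSum_le (x : EuclideanSpace ℝ (Fin n)) :
    bubbleSum ℓ b N p x ≤ N * bubbleProfile ℓ b b := by
  refine (Finset.sum_le_card_nsmul _ _ _ fun i _ => bubble_le_max (x - p i)).trans_eq ?_
  simp

theorem bubbleSum_eq_zero (hℓ : 0 < ℓ) {x : EuclideanSpace ℝ (Fin n)}
    (hx : ∀ i < N, Real.exp ℓ ≤ ‖x - p i‖) : bubbleSum ℓ b N p x = 0 :=
  Finset.sum_eq_zero fun i hi => bubble_eq_zero hℓ (hx i (Finset.mem_range.1 hi))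

/-- Each bubble is supported in the ball of radius `e^ℓ` about its centre; if the centres are at
mutual distance `3 e^ℓ`, only one of them contributes in a ball of radius `2 e^ℓ` about a centre. -/
theorem bubbleSum_eq_bubble (hℓ : 0 < ℓ)
    (hp : ∀ i j, i ≠ j → 3 * Real.exp ℓ ≤ ‖p i - p j‖) {i : ℕ} (hi : i < N)
    {x : EuclideanSpace ℝ (Fin n)} (hx : ‖x - p i‖ ≤ 2 * Real.exp ℓ) :
    bubbleSum ℓ b N p x = bubble ℓ b (x - p i) := by
  refine Finset.sum_eq_single_of_mem i (Finset.mem_range.2 hi) fun j _ hji => bubble_eq_zero hℓ ?_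
  have h1 := hp i j hji.symm
  have h2 := norm_sub_le_norm_sub_add_norm_sub (p i) x (p j)
  rw [norm_sub_rev (p i) x] at h2
  linarith

/-- Near each point the exponent is that of a single bubble. A point outside all bubbles causes no
exception, since every single bubble vanishes there. -/
theorem exists_bubbleSum_eventuallyEq (hℓ : 0 < ℓ) (hN : 0 < N)
    (hp : ∀ i j, i ≠ j → 3 * Real.exp ℓ ≤ ‖p i - p j‖) (x : EuclideanSpace ℝ (Fin n)) :
    ∃ i < N, bubbleSum ℓ b N p =ᶠ[𝓝 x] fun y => bubble ℓ b (y - p i) := by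
  have hρ := Real.exp_pos ℓ
  have hopen (i : ℕ) : Continuous fun y : EuclideanSpace ℝ (Fin n) => ‖y - p i‖ := by fun_prop
  by_cases h : ∃ i < N, ‖x - p i‖ < 2 * Real.exp ℓ
  · obtain ⟨i, hi, hx⟩ := h
    refine ⟨i, hi, ?_⟩
    filter_upwards [(hopen i).continuousAt.eventually_lt continuousAt_const hx] with y hy
    exact bubbleSum_eq_bubble hℓ hp hi hy.le
  · push Not at h
    have hall : ∀ᶠ y in 𝓝 x, ∀ i ∈ Finset.range N, Real.exp ℓ < ‖y - p i‖ := by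
      rw [Finset.eventually_all]
      intro i hi
      refine continuousAt_const.eventually_lt (hopen i).continuousAt ?_
      have := h i (Finset.mem_range.1 hi)
      linarith
    refine ⟨0, hN, ?_⟩
    filter_upwards [hall] with y hy
    rw [bubbleSum_eq_zero hℓ fun i hi => (hy i (Finset.mem_range.2 hi)).le,
      bubble_eq_zero hℓ (hy 0 (Finset.mem_range.2 hN)).le]

/-- Negative curvature occurs only in the necks, the annuli `1 ≤ r ≤ e^ℓ` about the centres. -/
theorem exists_sigmaMinus_bubbleSum_le {K : ℝ} (hK : ∀ t, deriv Real.smoothTransition t ≤ K)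
    (hℓ : 0 < ℓ) (hN : 0 < N) (hn : 1 ≤ n)
    (hp : ∀ i j, i ≠ j → 3 * Real.exp ℓ ≤ ‖p i - p j‖) (x : EuclideanSpace ℝ (Fin n)) :
    ∃ i < N, sigmaMinus (conformalMetric (bubbleSum ℓ b N p) (contDiff_bubbleSum ℓ b N p)) x ≤
      ENNReal.ofReal (Real.exp (-(2 * bubbleSum ℓ b N p x)) *
        (Icc (1 : ℝ) (Real.exp ℓ)).indicator (fun r => 2 * K / ℓ * (r ^ 2)⁻¹) ‖x - p i‖) := by
  obtain ⟨i, hi, hev⟩ := exists_bubbleSum_eventuallyEq (b := b) hℓ hN hp x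
  refine ⟨i, hi, ?_⟩
  have hK0 : 0 ≤ K := (deriv_smoothTransition_nonneg 0).trans (hK 0)
  by_cases hx : x = p i
  · have hconst : bubbleSum ℓ b N p =ᶠ[𝓝 x] fun _ => bubbleProfile ℓ b b := by
      filter_upwards [hev, Metric.ball_mem_nhds x (Real.exp_pos b)] with y hy hyb
      rw [mem_ball_iff_norm, hx] at hyb
      rw [hy, bubble_of_le hyb.le]
    exact (sigmaMinus_eq_zero_of_eventually_const hn _ hconst).trans_le zero_le
  · have hrad : bubbleSum ℓ b N p =ᶠ[𝓝 x] fun y => bubbleProfile ℓ b (Real.log ‖y - p i‖) := by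
      filter_upwards [hev, isOpen_ne.mem_nhds hx] with y hy hyp
      rw [hy, bubble_of_ne (sub_ne_zero.2 hyp)]
    have hpos : 0 < ‖x - p i‖ := norm_pos_iff.2 (sub_ne_zero.2 hx)
    refine (sigmaMinus_radial_le (hasDerivAt_bubbleProfile ℓ b) (hasDerivAt_bubbleSlope ℓ b)
      (bubbleSlope_nonpos ℓ b) (neg_two_le_bubbleSlope ℓ b) _ hx hrad).trans
      (ENNReal.ofReal_le_ofReal (mul_le_mul_of_nonneg_left ?_ (Real.exp_pos _).le))
    refine (mul_le_mul_of_nonneg_right (deriv_bubbleSlope_le (b := b) hK hℓ (Real.log ‖x - p i‖))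
      (by positivity)).trans_eq ?_
    have hiff : Real.log ‖x - p i‖ ∈ Icc 0 ℓ ↔ ‖x - p i‖ ∈ Icc 1 (Real.exp ℓ) := by
      rw [mem_Icc, mem_Icc, Real.le_log_iff_exp_le hpos, Real.log_le_iff_le_exp hpos, Real.exp_zero]
    simp only [indicator_apply, hiff, ite_mul, zero_mul]

theorem sigmaMinus_bubbleSum_le {K : ℝ} (hK : ∀ t, deriv Real.smoothTransition t ≤ K)
    (hℓ : 0 < ℓ) (hN : 0 < N) (hn : 1 ≤ n)
    (hp : ∀ i j, i ≠ j → 3 * Real.exp ℓ ≤ ‖p i - p j‖) (x : EuclideanSpace ℝ (Fin n)) :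
    sigmaMinus (conformalMetric (bubbleSum ℓ b N p) (contDiff_bubbleSum ℓ b N p)) x ≤
      ENNReal.ofReal (2 * K / ℓ) := by
  have hK0 : 0 ≤ K := (deriv_smoothTransition_nonneg 0).trans (hK 0)
  obtain ⟨i, -, h⟩ := exists_sigmaMinus_bubbleSum_le (b := b) hK hℓ hN hn hp x
  refine h.trans (ENNReal.ofReal_le_ofReal ?_)
  have h1 : (Icc (1 : ℝ) (Real.exp ℓ)).indicator (fun r => 2 * K / ℓ * (r ^ 2)⁻¹) ‖x - p i‖ ≤
      2 * K / ℓ := by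
    rw [indicator_apply]
    split_ifs with hr
    · exact mul_le_of_le_one_right (by positivity) (inv_le_one_of_one_le₀ (one_le_pow₀ hr.1))
    · positivity
  have h2 : Real.exp (-(2 * bubbleSum ℓ b N p x)) ≤ 1 :=
    Real.exp_le_one_iff.2 (by linarith [bubbleSum_nonneg (b := b) (N := N) (p := p) hℓ x])
  exact (mul_le_mul_of_nonneg_left h1 (Real.exp_pos _).le).trans
    (mul_le_of_le_one_left (by positivity) h2)

/-- The factors `e^{-nf}` of `σ₋^{n/2}` and `e^{nf}` of the volume density cancel, and each neck costs
a multiple of `∫ ℓ^{-n/2} ‖x‖^{-n} dx`, that is, of `ℓ^{1-n/2}`. -/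
theorem lintegral_sigmaMinus_bubbleSum_le {K : ℝ} (hK0 : 0 < K)
    (hK : ∀ t, deriv Real.smoothTransition t ≤ K)
    (hℓ : 0 < ℓ) (hN : 0 < N) (hn : 1 ≤ n)
    (hp : ∀ i j, i ≠ j → 3 * Real.exp ℓ ≤ ‖p i - p j‖) :
    ∫⁻ x, sigmaMinus (conformalMetric (bubbleSum ℓ b N p) (contDiff_bubbleSum ℓ b N p)) x
        ^ ((n : ℝ) / 2)
      ∂(vol (conformalMetric (bubbleSum ℓ b N p) (contDiff_bubbleSum ℓ b N p))) ≤
      ENNReal.ofReal (N * (n * (volume : Measure (EuclideanSpace ℝ (Fin n))).real (Metric.ball 0 1)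
        * ((2 * K / ℓ) ^ ((n : ℝ) / 2) * ℓ))) := by
  set f := bubbleSum ℓ b N p with hfdef
  set c := (2 * K / ℓ) ^ ((n : ℝ) / 2)
  have hc : 0 ≤ c := by positivity
  have hf : ContDiff ℝ ∞ f := contDiff_bubbleSum ℓ b N p
  set G : ℝ → ℝ := (Icc (1 : ℝ) (Real.exp ℓ)).indicator fun r => c * (r ^ n)⁻¹
  have hGm : Measurable G := by
    refine Measurable.indicator ?_ measurableSet_Icc
    fun_prop
  have hm : Measurable fun x => ENNReal.ofReal (Real.exp (n * f x)) := by
    have := hf.continuous.measurable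
    fun_prop
  rw [vol_conformalMetric]
  refine (lintegral_withDensity_le_lintegral_mul _ hm _).trans ?_
  have hle (x : EuclideanSpace ℝ (Fin n)) : ENNReal.ofReal (Real.exp (n * f x)) *
      sigmaMinus (conformalMetric f hf) x ^ ((n : ℝ) / 2) ≤
      ∑ i ∈ Finset.range N, ENNReal.ofReal (G ‖x - p i‖) := by
    obtain ⟨i, hi, h⟩ := exists_sigmaMinus_bubbleSum_le (b := b) hK hℓ hN hn hp x
    refine le_trans ?_ (Finset.single_le_sum (f := fun i => ENNReal.ofReal (G ‖x - p i‖))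
      (fun _ _ => zero_le) (Finset.mem_range.2 hi))
    refine (mul_le_mul_right (ENNReal.rpow_le_rpow h (by positivity)) _).trans ?_
    have hind : 0 ≤ (Icc (1 : ℝ) (Real.exp ℓ)).indicator (fun r => 2 * K / ℓ * (r ^ 2)⁻¹)
        ‖x - p i‖ := indicator_nonneg (fun r _ => by positivity) _
    rw [ENNReal.ofReal_rpow_of_nonneg (by positivity) (by positivity),
      ← ENNReal.ofReal_mul (Real.exp_pos _).le]
    refine ENNReal.ofReal_le_ofReal (le_of_eq ?_)
    rw [Real.mul_rpow (Real.exp_pos _).le hind, ← Real.exp_mul, ← mul_assoc, ← Real.exp_add]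
    have h0 : n * f x + -(2 * bubbleSum ℓ b N p x) * ((n : ℝ) / 2) = 0 := by
      rw [← hfdef]; ring
    rw [h0, Real.exp_zero, one_mul]
    by_cases hr : ‖x - p i‖ ∈ Icc (1 : ℝ) (Real.exp ℓ)
    · simp only [G, indicator_of_mem hr]
      have hpos : 0 < ‖x - p i‖ := lt_of_lt_of_le one_pos hr.1
      rw [Real.mul_rpow (by positivity) (by positivity), Real.inv_rpow (by positivity),
        ← Real.rpow_natCast_mul hpos.le]
      congr 2
      rw [← Real.rpow_natCast]
      congr 1
      push_cast
      ring
    · simp only [G, indicator_of_notMem hr]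
      exact Real.zero_rpow (by positivity)
  refine (lintegral_mono hle).trans ?_
  rw [lintegral_finsetSum _ fun i _ => by fun_prop]
  have htr (i : ℕ) : ∫⁻ x, ENNReal.ofReal (G ‖x - p i‖) = ENNReal.ofReal
      (n * (volume : Measure (EuclideanSpace ℝ (Fin n))).real (Metric.ball 0 1) * (c * ℓ)) := by
    rw [← lintegral_annulus_inv_pow hn hℓ hc]
    exact lintegral_sub_right_eq_self (fun x => ENNReal.ofReal (G ‖x‖)) (p i)
  simp only [htr, Finset.sum_const, Finset.card_range, nsmul_eq_mul]
  rw [ENNReal.ofReal_mul (Nat.cast_nonneg N), ENNReal.ofReal_natCast]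

theorem le_vol_ball_bubbleSum (hℓ : 0 < ℓ) (hb : b ≤ -1)
    (hp : ∀ i j, i ≠ j → 3 * Real.exp ℓ ≤ ‖p i - p j‖) {i : ℕ} (hi : i < N) :
    ENNReal.ofReal (Real.exp (n * (neckHeight ℓ - b - 1)) *
        (volume : Measure (EuclideanSpace ℝ (Fin n))).real (Metric.ball 0 1)) ≤
      vol (conformalMetric (bubbleSum ℓ b N p) (contDiff_bubbleSum ℓ b N p))
        (Metric.ball (p i) (Real.exp (b + 1))) := by
  rw [vol_conformalMetric, withDensity_apply _ measurableSet_ball]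
  have hone : Real.exp (b + 1) ≤ 2 * Real.exp ℓ := by
    have h1 : Real.exp (b + 1) ≤ 1 := Real.exp_le_one_iff.2 (by linarith)
    have h2 := Real.one_le_exp hℓ.le
    linarith
  calc _ = ENNReal.ofReal (Real.exp (n * (neckHeight ℓ - 2 * (b + 1)))) *
        volume (Metric.ball (p i) (Real.exp (b + 1))) := by
        rw [Measure.addHaar_ball_of_pos _ _ (Real.exp_pos _), finrank_euclideanSpace_fin,
          ← mul_assoc, ← ENNReal.ofReal_mul (Real.exp_pos _).le, ← Real.exp_nat_mul,
          ← Real.exp_add, ENNReal.ofReal_mul (Real.exp_pos _).le,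
          ofReal_measureReal measure_ball_lt_top.ne]
        ring_nf
    _ = ∫⁻ _ in Metric.ball (p i) (Real.exp (b + 1)),
          ENNReal.ofReal (Real.exp (n * (neckHeight ℓ - 2 * (b + 1)))) := by
        rw [setLIntegral_const]
    _ ≤ _ := by
        refine setLIntegral_mono' measurableSet_ball fun x hx => ?_
        rw [mem_ball_iff_norm] at hx
        rw [bubbleSum_eq_bubble hℓ hp hi (hx.le.trans hone)]
        have := le_bubble hℓ hb hx.le
        gcongr

theorem distance_center_bubbleSum_le (hℓ : 0 < ℓ) (hb : b ≤ -1)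
    (hp : ∀ i j, i ≠ j → 3 * Real.exp ℓ ≤ ‖p i - p j‖) {i : ℕ} (hi : i < N)
    {v : EuclideanSpace ℝ (Fin n)} (hv : ‖v‖ ≤ 2 * Real.exp ℓ) :
    distance (conformalMetric (bubbleSum ℓ b N p) (contDiff_bubbleSum ℓ b N p)) (p i) (p i + v) ≤
      ENNReal.ofReal (Real.exp (neckHeight ℓ) * (‖v‖ + Real.pi / Real.exp b)) := by
  refine (distance_conformalMetric_le_segment _ _ _ _).trans
    (le_trans (setLIntegral_mono' measurableSet_Icc fun t ht => ?_)
      (lintegral_exp_bubble_le hℓ hb v))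
  have h : ‖p i + t • v - p i‖ ≤ 2 * Real.exp ℓ := by
    rw [add_sub_cancel_left, norm_smul, Real.norm_eq_abs, abs_of_nonneg ht.1]
    exact (mul_le_of_le_one_left (norm_nonneg v) ht.2).trans hv
  rw [bubbleSum_eq_bubble hℓ hp hi h, add_sub_cancel_left]

end BubbleSum

/-! ### Placing the bubbles -/

section Centers

variable {n : ℕ}

/-- Centres of bubbles of Euclidean radius `ρ`: equally spaced points on a line at distance `2ρ`
from a parallel coordinate axis, which therefore meets none of the bubbles. -/
noncomputable def bubbleCenter (j₀ j₁ : Fin n) (ρ : ℝ) (i : ℕ) : EuclideanSpace ℝ (Fin n) :=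
  EuclideanSpace.single j₀ (3 * ρ * i) + EuclideanSpace.single j₁ (2 * ρ)

theorem le_norm_bubbleCenter_sub (j₀ j₁ : Fin n) {ρ : ℝ} (hρ : 0 < ρ) (i j : ℕ) (hij : i ≠ j) :
    3 * ρ ≤ ‖bubbleCenter j₀ j₁ ρ i - bubbleCenter j₀ j₁ ρ j‖ := by
  have h : bubbleCenter j₀ j₁ ρ i - bubbleCenter j₀ j₁ ρ j =
      EuclideanSpace.single j₀ (3 * ρ * ((i : ℝ) - j)) := by
    rw [bubbleCenter, bubbleCenter, add_sub_add_right_eq_sub, mul_sub]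
    ext k
    simp only [PiLp.sub_apply, PiLp.single_apply]
    split_ifs <;> simp
  have h1 : (1 : ℝ) ≤ |(i : ℝ) - j| := by
    have : (1 : ℤ) ≤ |(i : ℤ) - j| := Int.one_le_abs (by omega)
    exact_mod_cast this
  rw [h, PiLp.norm_single, norm_mul, Real.norm_eq_abs, Real.norm_eq_abs,
    abs_of_pos (by positivity)]
  exact le_mul_of_one_le_right (by positivity) h1

theorem le_norm_axis_sub_bubbleCenter {j₀ j₁ : Fin n} (hj : j₀ ≠ j₁) {ρ : ℝ} (hρ : 0 < ρ) (s : ℝ)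
    (i : ℕ) : ρ ≤ ‖EuclideanSpace.single j₀ s - bubbleCenter j₀ j₁ ρ i‖ := by
  have h := PiLp.norm_apply_le (EuclideanSpace.single j₀ s - bubbleCenter j₀ j₁ ρ i) j₁
  have h1 : (EuclideanSpace.single j₀ s - bubbleCenter j₀ j₁ ρ i) j₁ = -(2 * ρ) := by
    simp [bubbleCenter, hj.symm]
  rw [h1, norm_neg, Real.norm_eq_abs, abs_of_pos (by positivity)] at h
  linarith

variable {N : ℕ} {ℓ b : ℝ}

/-- A cap is reached from the origin along the axis, then straight to the centre of the bubble, then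
along a ray. -/
theorem distance_zero_bubbleSum_le {j₀ j₁ : Fin n} (hj : j₀ ≠ j₁) (hℓ : 0 < ℓ) (hb : b ≤ -1)
    {i : ℕ} (hi : i < N) {x : EuclideanSpace ℝ (Fin n)}
    (hx : ‖x - bubbleCenter j₀ j₁ (Real.exp ℓ) i‖ ≤ 1) :
    distance (conformalMetric (bubbleSum ℓ b N (bubbleCenter j₀ j₁ (Real.exp ℓ)))
        (contDiff_bubbleSum ℓ b N _)) 0 x ≤
      ENNReal.ofReal (3 * Real.exp ℓ * N + Real.exp (neckHeight ℓ) * (2 * Real.exp ℓ + 1)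
        + 2 * Real.pi * Real.exp (neckHeight ℓ - b)) := by
  set ρ := Real.exp ℓ
  have hρ : 0 < ρ := Real.exp_pos ℓ
  have hρ1 : 1 ≤ ρ := Real.one_le_exp hℓ.le
  set p := bubbleCenter j₀ j₁ ρ
  set f := bubbleSum ℓ b N p
  set g := conformalMetric f (contDiff_bubbleSum ℓ b N p)
  have hp := le_norm_bubbleCenter_sub j₀ j₁ hρ
  set q : EuclideanSpace ℝ (Fin n) := EuclideanSpace.single j₀ (3 * ρ * i)
  have h1 : distance g 0 q ≤ ENNReal.ofReal (3 * ρ * N) := by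
    have h := distance_conformalMetric_le_of_bound f (contDiff_bubbleSum ℓ b N p) 0 q (M := 0)
      fun t _ => by
        refine (bubbleSum_eq_zero hℓ fun k _ => ?_).le
        have := le_norm_axis_sub_bubbleCenter hj hρ (t * (3 * ρ * i)) k
        have hq : 0 + t • q = EuclideanSpace.single j₀ (t * (3 * ρ * i)) := by
          ext k
          simp [q, PiLp.single_apply]
        rwa [hq]
    rw [zero_add] at h
    refine h.trans (ENNReal.ofReal_le_ofReal ?_)
    rw [Real.exp_zero, one_mul, PiLp.norm_single, Real.norm_eq_abs,
      abs_of_nonneg (by positivity)]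
    have : (i : ℝ) ≤ N := by exact_mod_cast hi.le
    gcongr
  have h2 : distance g q (p i) ≤
      ENNReal.ofReal (Real.exp (neckHeight ℓ) * (2 * ρ + Real.pi / Real.exp b)) := by
    have hn : ‖-EuclideanSpace.single j₁ (2 * ρ)‖ = 2 * ρ := by
      rw [norm_neg, PiLp.norm_single, Real.norm_eq_abs, abs_of_pos (by positivity)]
    have h := distance_center_bubbleSum_le (b := b) hℓ hb hp hi hn.le
    rw [hn] at h
    have hq : p i + -EuclideanSpace.single j₁ (2 * ρ) = q := by
      simp only [p, q, bubbleCenter]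
      abel
    rw [hq] at h
    rwa [distance_comm]
  have h3 : distance g (p i) x ≤
      ENNReal.ofReal (Real.exp (neckHeight ℓ) * (1 + Real.pi / Real.exp b)) := by
    have h := distance_center_bubbleSum_le (b := b) hℓ hb hp hi (v := x - p i) (by linarith)
    rw [add_sub_cancel] at h
    refine h.trans (ENNReal.ofReal_le_ofReal ?_)
    gcongr
  have hpi := Real.pi_pos
  calc distance g 0 x ≤ distance g 0 q + distance g q x := distance_triangle g _ _ _
    _ ≤ distance g 0 q + (distance g q (p i) + distance g (p i) x) := by
        gcongr
        exact distance_triangle g _ _ _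
    _ ≤ _ := add_le_add h1 (add_le_add h2 h3)
    _ = _ := by
        rw [← ENNReal.ofReal_add (by positivity) (by positivity),
          ← ENNReal.ofReal_add (by positivity) (by positivity), Real.exp_sub]
        congr 1
        ring

end Centers

/-! ### Choice of the parameters -/

section Main

/-- The length of the path from the origin into a cap is eventually below the radius `exp L`. -/
theorem exists_length_lt (m : ℝ) : ∃ L₀ : ℝ, 8 ≤ L₀ ∧ ∀ L ≥ L₀,
    3 * Real.exp (L / 4) * (L ^ m + 1) + Real.exp (L / 2) * (2 * Real.exp (L / 4) + 1)
      + 2 * Real.pi * Real.exp (L - 3) < Real.exp L := by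
  have h1 : ∀ᶠ L : ℝ in atTop, ‖L ^ m‖ ≤ 1 * ‖Real.exp (1 / 4 * L)‖ :=
    (isLittleO_rpow_exp_pos_mul_atTop m (by norm_num : (0 : ℝ) < 1 / 4)).bound one_pos
  have h2 : ∀ᶠ L : ℝ in atTop, 8 ≤ Real.exp (L / 4) :=
    (Real.tendsto_exp_atTop.comp (tendsto_id.atTop_div_const (by norm_num))).eventually_ge_atTop 8
  obtain ⟨L₁, hL₁⟩ := eventually_atTop.1 (h1.and h2)
  refine ⟨max L₁ 8, le_max_right _ _, fun L hL => ?_⟩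
  obtain ⟨h3, h4⟩ := hL₁ L ((le_max_left _ _).trans hL)
  set y := Real.exp (L / 4)
  have h5 : L ^ m ≤ y := by
    rw [one_mul, Real.norm_of_nonneg (Real.exp_pos _).le, one_div_mul_eq_div] at h3
    exact (Real.le_norm_self _).trans h3
  have h6 : Real.exp (L / 2) = y ^ 2 := by
    rw [← Real.exp_nat_mul]; congr 1; push_cast; ring
  have h7 : Real.exp L = y ^ 4 := by
    rw [← Real.exp_nat_mul]; congr 1; push_cast; ring
  have h8 : Real.exp (L - 3) * 16 ≤ y ^ 4 := by
    have : (16 : ℝ) ≤ Real.exp 3 := by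
      have e1 : Real.exp 3 = Real.exp 1 ^ 3 := by rw [← Real.exp_nat_mul]; norm_num
      have e2 := Real.exp_one_gt_d9
      have e3 := pow_le_pow_left₀ (by norm_num : (0 : ℝ) ≤ 2.7) (by linarith : 2.7 ≤ Real.exp 1) 3
      rw [e1]
      norm_num at e3 ⊢
      linarith
    rw [← h7, Real.exp_sub, div_mul_eq_mul_div, div_le_iff₀ (Real.exp_pos _)]
    exact mul_le_mul_of_nonneg_left this (Real.exp_pos _).le
  have h9 : 2 * Real.pi * Real.exp (L - 3) ≤ y ^ 4 / 2 := by
    have e1 : 2 * Real.pi ≤ 8 := by linarith [Real.pi_le_four]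
    have := mul_le_mul_of_nonneg_right e1 (Real.exp_pos (L - 3)).le
    linarith
  have h10 : 3 * y * (L ^ m + 1) ≤ 3 * y * (y + 1) := by gcongr
  have h11 : 8 * y ^ 3 ≤ y ^ 4 := by
    have := mul_le_mul_of_nonneg_right h4 (by positivity : 0 ≤ y ^ 3)
    linarith
  have h12 : 8 * y ^ 2 ≤ y ^ 3 := by
    have := mul_le_mul_of_nonneg_right h4 (by positivity : 0 ≤ y ^ 2)
    linarith
  have h13 : 8 * y ≤ y ^ 2 := by
    have := mul_le_mul_of_nonneg_right h4 (by positivity : 0 ≤ y)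
    linarith
  rw [h6, h7]
  nlinarith

/-- With `N ≈ L ^ (n / 2 - 1)` bubbles whose necks have logarithmic length `L / 4`, the total
negative curvature stays bounded. -/
theorem bubble_cost_le {n : ℕ} (hn : 3 ≤ n) {K κ L : ℝ} (hK : 0 < K) (hκ : 0 < κ) (hL : 8 ≤ L) :
    (⌈L ^ ((n : ℝ) / 2 - 1)⌉₊ : ℝ) * (n * κ * ((2 * K / (L / 4)) ^ ((n : ℝ) / 2) * (L / 4))) ≤
      2 * n * κ * ((8 * K) ^ ((n : ℝ) / 2) / 4) := by
  have hn' : (3 : ℝ) ≤ n := by exact_mod_cast hn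
  have hL0 : 0 < L := by linarith
  have h1 : 1 ≤ L ^ ((n : ℝ) / 2 - 1) := Real.one_le_rpow (by linarith) (by linarith)
  have h2 : (⌈L ^ ((n : ℝ) / 2 - 1)⌉₊ : ℝ) ≤ 2 * L ^ ((n : ℝ) / 2 - 1) := by
    have := (Nat.ceil_lt_add_one (by positivity : 0 ≤ L ^ ((n : ℝ) / 2 - 1))).le
    linarith
  have h3 : (2 * K / (L / 4)) ^ ((n : ℝ) / 2) = (8 * K) ^ ((n : ℝ) / 2) / L ^ ((n : ℝ) / 2) := by
    rw [← Real.div_rpow (by positivity) hL0.le]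
    congr 1
    field_simp
    ring
  have h4 : L ^ ((n : ℝ) / 2) = L ^ ((n : ℝ) / 2 - 1) * L := by
    rw [Real.rpow_sub_one hL0.ne', div_mul_cancel₀ _ hL0.ne']
  refine (mul_le_mul_of_nonneg_right h2 (by positivity)).trans_eq ?_
  rw [h3, h4]
  field_simp

end Main

end RiemannianRn

open RiemannianRn MeasureTheory

theorem mainTheorem3 (n : ℕ) (hn : 3 ≤ n) :
    ∃ C : ℝ, 0 < C ∧ ∀ R : ℝ, 3 < R →
      ∃ (f : EuclideanSpace ℝ (Fin n) → ℝ) (hf : ContDiff ℝ ∞ f),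
        RiemannianRn.IsCompleteMetric (RiemannianRn.conformalMetric f hf) ∧
        (∀ x, RiemannianRn.sigmaMinus (RiemannianRn.conformalMetric f hf) x
          ≤ ENNReal.ofReal C) ∧
        ∫⁻ x, RiemannianRn.sigmaMinus (RiemannianRn.conformalMetric f hf) x ^ ((n : ℝ) / 2)
          ∂(RiemannianRn.vol (RiemannianRn.conformalMetric f hf)) ≤ ENNReal.ofReal C ∧
        ENNReal.ofReal (R ^ n * Real.log R ^ ((n : ℝ) / 2 - 1) / C)
          ≤ RiemannianRn.vol (RiemannianRn.conformalMetric f hf)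
              (RiemannianRn.geodesicBall (RiemannianRn.conformalMetric f hf) 0 R) := by
  have hn1 : 1 ≤ n := by omega
  have hn' : (3 : ℝ) ≤ n := by exact_mod_cast hn
  have hm : 0 ≤ (n : ℝ) / 2 - 1 := by linarith
  obtain ⟨K, hK0, hK⟩ := exists_deriv_smoothTransition_le
  obtain ⟨L₀, hL₀8, hL₀⟩ := exists_length_lt ((n : ℝ) / 2 - 1)
  set κ := (volume : Measure (EuclideanSpace ℝ (Fin n))).real (Metric.ball 0 1)
  have hκ : 0 < κ := ENNReal.toReal_pos (Metric.measure_ball_pos _ _ one_pos).ne'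
    measure_ball_lt_top.ne
  set C₁ := 2 * n * κ * ((8 * K) ^ ((n : ℝ) / 2) / 4)
  have hC₁ : 0 ≤ C₁ := by positivity
  set C₂ := Real.exp (4 * n) / κ
  have hC₂ : 0 < C₂ := by positivity
  set C₃ := L₀ ^ ((n : ℝ) / 2 - 1) / κ
  have hC₃ : 0 ≤ C₃ := by positivity
  refine ⟨K + C₁ + C₂ + C₃, by positivity, fun R hR => ?_⟩
  have hR0 : 0 < R := by linarith
  have hlog : 0 < Real.log R := Real.log_pos (by linarith)
  rcases lt_or_ge (Real.log R) L₀ with hRL | hRL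
  · -- The Euclidean metric serves for bounded `R`.
    have hf : ContDiff ℝ ∞ (fun _ : EuclideanSpace ℝ (Fin n) => (0 : ℝ)) := contDiff_const
    have hσ (x : EuclideanSpace ℝ (Fin n)) : sigmaMinus (conformalMetric (fun _ => 0) hf) x = 0 :=
      sigmaMinus_eq_zero_of_eventually_const hn1 hf (Filter.Eventually.of_forall fun _ => rfl)
    refine ⟨fun _ => 0, hf, isCompleteMetric_conformalMetric _ hf (fun _ => le_rfl)
      (fun _ => le_rfl), fun x => by simp [hσ], ?_, ?_⟩
    · simp only [hσ]
      rw [ENNReal.zero_rpow_of_pos (by positivity)]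
      simp
    · have hv : vol (conformalMetric (fun _ : EuclideanSpace ℝ (Fin n) => (0 : ℝ)) hf) = volume := by
        rw [vol_conformalMetric]
        simp
      have hsub : Metric.ball 0 R ⊆ geodesicBall
          (conformalMetric (fun _ : EuclideanSpace ℝ (Fin n) => (0 : ℝ)) hf) 0 R := by
        intro x hx
        rw [mem_ball_zero_iff] at hx
        have h := distance_conformalMetric_le_of_bound _ hf 0 x (M := 0) fun _ _ => le_rfl
        rw [zero_add, Real.exp_zero, one_mul] at h
        exact h.trans_lt ((ENNReal.ofReal_lt_ofReal_iff hR0).2 hx)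
      rw [hv]
      refine le_trans ?_ (measure_mono hsub)
      rw [Measure.addHaar_ball_of_pos _ _ hR0, finrank_euclideanSpace_fin,
        ← ofReal_measureReal measure_ball_lt_top.ne, ← ENNReal.ofReal_mul (by positivity)]
      refine ENNReal.ofReal_le_ofReal ?_
      rw [div_le_iff₀ (by positivity), mul_assoc]
      refine mul_le_mul_of_nonneg_left ?_ (by positivity)
      calc Real.log R ^ ((n : ℝ) / 2 - 1) ≤ L₀ ^ ((n : ℝ) / 2 - 1) :=
            Real.rpow_le_rpow hlog.le hRL.le hm
        _ = κ * C₃ := by simp only [C₃]; field_simp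
        _ ≤ _ := mul_le_mul_of_nonneg_left (by linarith) hκ.le
  · set L := Real.log R with hL
    have hL8 : 8 ≤ L := hL₀8.trans hRL
    have hexpL : Real.exp L = R := Real.exp_log hR0
    set N := ⌈L ^ ((n : ℝ) / 2 - 1)⌉₊
    have hN : 0 < N := Nat.ceil_pos.2 (Real.rpow_pos_of_pos hlog _)
    set ℓ := L / 4 with hℓdef
    have hℓ : 0 < ℓ := by positivity
    -- This gives caps of size `e^(neckHeight ℓ - b) = e^(-3) R`; as `2π e^(-3) < 1`, a path into and
    -- out of the centre of a bubble is shorter than `R`.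
    set b := neckHeight ℓ - L + 3 with hbdef
    have hneck : neckHeight ℓ ≤ L / 2 := (neckHeight_le hℓ).trans_eq (by rw [hℓdef]; ring)
    have hb : b ≤ -1 := by linarith
    let j₀ : Fin n := ⟨0, by omega⟩
    let j₁ : Fin n := ⟨1, by omega⟩
    have hj : j₀ ≠ j₁ := by simp [j₀, j₁]
    set p := bubbleCenter j₀ j₁ (Real.exp ℓ)
    have hp : ∀ i j, i ≠ j → 3 * Real.exp ℓ ≤ ‖p i - p j‖ :=
      le_norm_bubbleCenter_sub j₀ j₁ (Real.exp_pos ℓ)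
    have hone : Real.exp (b + 1) ≤ 1 := Real.exp_le_one_iff.2 (by linarith)
    refine ⟨bubbleSum ℓ b N p, contDiff_bubbleSum ℓ b N p,
      isCompleteMetric_conformalMetric _ _ (bubbleSum_nonneg hℓ) bubbleSum_le, fun x => ?_, ?_, ?_⟩
    · refine (sigmaMinus_bubbleSum_le hK hℓ hN hn1 hp x).trans (ENNReal.ofReal_le_ofReal ?_)
      have : 2 * K / ℓ ≤ K := by
        rw [div_le_iff₀ hℓ, mul_comm]
        exact mul_le_mul_of_nonneg_left (by linarith) hK0.le
      linarith
    · refine (lintegral_sigmaMinus_bubbleSum_le hK0 hK hℓ hN hn1 hp).trans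
        (ENNReal.ofReal_le_ofReal ?_)
      refine (bubble_cost_le hn hK0 hκ hL8).trans ?_
      change C₁ ≤ _
      linarith
    · set g := conformalMetric (bubbleSum ℓ b N p) (contDiff_bubbleSum ℓ b N p)
      have hsub : ⋃ i ∈ Finset.range N, Metric.ball (p i) (Real.exp (b + 1)) ⊆
          geodesicBall g 0 R := by
        refine Set.iUnion₂_subset fun i hi x hx => ?_
        rw [mem_ball_iff_norm] at hx
        refine (distance_zero_bubbleSum_le hj hℓ hb (Finset.mem_range.1 hi)
          (hx.le.trans hone)).trans_lt ((ENNReal.ofReal_lt_ofReal_iff hR0).2 ?_)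
        rw [← hexpL]
        refine lt_of_le_of_lt ?_ (hL₀ L hRL)
        have h1 : (N : ℝ) ≤ L ^ ((n : ℝ) / 2 - 1) + 1 :=
          (Nat.ceil_lt_add_one (by positivity)).le
        have h2 : neckHeight ℓ - b = L - 3 := by rw [hbdef]; ring
        rw [h2]
        gcongr
      have hdisj : (Finset.range N : Set ℕ).PairwiseDisjoint
          fun i => Metric.ball (p i) (Real.exp (b + 1)) := by
        intro i _ j _ hij
        refine Metric.ball_disjoint_ball ?_
        rw [dist_eq_norm]
        have := hp i j hij
        have := Real.one_le_exp hℓ.le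
        linarith
      refine le_trans ?_ (measure_mono hsub)
      rw [measure_biUnion_finset hdisj fun _ _ => measurableSet_ball]
      refine le_trans ?_ (Finset.sum_le_sum fun i hi =>
        le_vol_ball_bubbleSum hℓ hb hp (Finset.mem_range.1 hi))
      rw [Finset.sum_const, Finset.card_range, nsmul_eq_mul, ← ENNReal.ofReal_natCast,
        ← ENNReal.ofReal_mul (Nat.cast_nonneg N)]
      refine ENNReal.ofReal_le_ofReal ?_
      have h1 : Real.exp (n * (neckHeight ℓ - b - 1)) = R ^ n / Real.exp (4 * n) := by
        rw [← hexpL, ← Real.exp_nat_mul, ← Real.exp_sub, hbdef]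
        congr 1
        ring
      rw [h1, div_le_iff₀ (by positivity)]
      calc R ^ n * L ^ ((n : ℝ) / 2 - 1) ≤ R ^ n * N := by
            gcongr
            exact Nat.le_ceil _
        _ = N * (R ^ n / Real.exp (4 * n) * κ) * C₂ := by
            simp only [C₂]
            field_simp
        _ ≤ _ := mul_le_mul_of_nonneg_left (by linarith) (by positivity)
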